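/- Let $S$ be a connected closed surface with a (finite, simplicial) triangulation $T$ with vertex set $V$ and face set $F$. For $I\subset V$ let $F_I\subset F$ be the set of faces having at least one vertex in $I$. For disjoint $I_1,I_2\subset V$ let $S_{I_1,I_2}$ be obtained from $S$ by removing small open disc neighbourhoods of the vertices in $I_1$ and the vertices in $I_2$, and let $T_{I_1,I_2}=T\cap S_{I_1,I_2}$ be its pseudo ideal triangulation. A generalized hyperbolic circle packing metric on $(S_{I_1,I_2},T_{I_1,I_2})$ is a map $k:V\to\mathbb{R}_{>0}$ with $k(i)<1$ for $i\in I_1$, $k(i)=1$ for $i\in I_2$, and $k(i)>1$ for $i\in V\setminus(I_1\cup I_2)$. It induces the following packing: each face $ijk$ is realized in the hyperbolic plane by three mutually externally tangent curves $C_i,C_j,C_k$ of geodesic curvatures $k(i),k(j),k(k)$, where a curve of curvature $>1$ is a circle (of radius $r$ with $\coth r$ equal to the curvature), a curve of curvature $1$ is a horocycle, and a curve of curvature $<1$ is a hypercycle (at distance $r$ from its axis, with $\tanh r$ equal to the curvature). Let $l_i^{jk}$ be the length of the arc of $C_i$ lying in the face $ijk$, between its two points of tangency with $C_j$ and $C_k$.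 The total geodesic curvature of $k$ at $i\in V$ is $L_i=k(i)\sum_{ijk\in F}l_i^{jk}$, the sum being over the faces containing $i$. Let $(L_i)_{i\in V}\in\mathbb{R}^V$. Then there exist disjoint $I_1,I_2\subset V$ and a generalized hyperbolic circle packing metric on $(S_{I_1,I_2},T_{I_1,I_2})$ having total geodesic curvature $L_i$ at each vertex $i\in V$ if and only if $$L_i>0\ \text{ for all } i\in V\qquad\text{and}\qquad \sum_{i\in I}L_i<\pi|F_I|\ \text{ for every nonempty subset } I\subset V.$$ Moreover, the metric $k$, and with it the sets $I_1$ and $I_2$, is unique if it exists. -/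

import Mathlib

open scoped UpperHalfPlane MatrixGroups Pointwise BigOperators

noncomputable section

/-! ### Triangulated surfaces -/

/-- The geometric realization, in barycentric coordinates, of the pure simplicial complex on the
vertex set `V` whose maximal simplices are `faces`: the points of the standard simplex on `V` whose
support is contained in one of the faces. -/
def simplicialRealization {V : Type*} [Fintype V] (faces : Finset (Finset V)) : Set (V → ℝ) :=
  {x | x ∈ stdSimplex ℝ V ∧ ∃ f ∈ faces, ∀ v, x v ≠ 0 → v ∈ f}

/-- A (finite, simplicial) triangulation of the space `S` with vertex set `V`: a set of triangles
(three-element subsets of `V`) such that every vertex is a corner of a triangle, and a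
homeomorphism between the simplicial complex made of these triangles and `S`. -/
structure Triangulation (S : Type*) [TopologicalSpace S] (V : Type*) [Fintype V] where
  faces : Finset (Finset V)
  card_face : ∀ f ∈ faces, f.card = 3
  exists_face : ∀ v : V, ∃ f ∈ faces, v ∈ f
  homeo : simplicialRealization faces ≃ₜ S

/-- `F_I`: the set of faces having at least one vertex in `I`. -/
def Triangulation.facesMeeting {S : Type*} [TopologicalSpace S] {V : Type*} [Fintype V]
    [DecidableEq V] (T : Triangulation S V) (I : Finset V) : Finset (Finset V) :=
  T.faces.filter fun f => ∃ v ∈ f, v ∈ I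

/-! ### Circles, horocycles and hypercycles in the hyperbolic plane `ℍ`

`ℍ` carries Mathlib's hyperbolic distance (curvature `-1`). A circle, horocycle or hypercycle is
the boundary in `ℍ` of the open convex region `D` ("generalized disc") towards which it curves. -/

/-- The open disc bounded by a hyperbolic circle of radius `r`. -/
def IsCircleDisc (r : ℝ) (D : Set ℍ) : Prop :=
  ∃ c : ℍ, D = Metric.ball c r

/-- An open horodisc, i.e. the region bounded by a horocycle: an image of `{Im z > 1}` under an
orientation preserving isometry. -/
def IsHorodisc (D : Set ℍ) : Prop :=
  ∃ A : SL(2, ℝ), D = A • {z : ℍ | 1 < z.im}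

/-- A closed half-plane of `ℍ`, bounded by a complete geodesic: an image of `{Re z ≤ 0}` under an
orientation preserving isometry. -/
def IsClosedHalfPlane (H : Set ℍ) : Prop :=
  ∃ A : SL(2, ℝ), H = A • {z : ℍ | z.re ≤ 0}

/-- The region bounded by a hypercycle of radius `r`: the open `r`-neighbourhood of a closed
half-plane. The axis of the hypercycle is the geodesic bounding the half-plane, and the hypercycle
consists of the points at distance `r` from the axis outside of the half-plane. -/
def IsHypercycleDisc (r : ℝ) (D : Set ℍ) : Prop :=
  ∃ H : Set ℍ, IsClosedHalfPlane H ∧ D = Metric.thickening r H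

/-- `D` is bounded by a circle, horocycle or hypercycle of geodesic curvature `k`: a circle of
radius `r` has curvature `coth r`, a horocycle has curvature `1`, a hypercycle of radius `r` has
curvature `tanh r`. -/
def IsGeneralizedDisc (k : ℝ) (D : Set ℍ) : Prop :=
  (∃ r : ℝ, 0 < r ∧ k = Real.cosh r / Real.sinh r ∧ IsCircleDisc r D) ∨
  (k = 1 ∧ IsHorodisc D) ∨
  (∃ r : ℝ, 0 < r ∧ k = Real.tanh r ∧ IsHypercycleDisc r D)

/-- External tangency of the boundary curves of two generalized discs: the open discs are disjoint
and their boundary curves have a common point in `ℍ`. -/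
def ExternallyTangent (D D' : Set ℍ) : Prop :=
  Disjoint D D' ∧ (frontier D ∩ frontier D').Nonempty

/-- The length of the (shorter) arc of the curve `C` between the sets `P` and `Q`: the infimum of
the hyperbolic lengths of the continuous paths inside `C` that start in `P` and end in `Q`. -/
def arcLengthBetween (C P Q : Set ℍ) : ENNReal :=
  ⨅ (γ : ℝ → ℍ) (_ : ContinuousOn γ (Set.Icc 0 1) ∧ (∀ t ∈ Set.Icc (0 : ℝ) 1, γ t ∈ C) ∧
    γ 0 ∈ P ∧ γ 1 ∈ Q), eVariationOn γ (Set.Icc 0 1)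

/-! ### Generalized hyperbolic circle packings -/

/-- `k` is a generalized hyperbolic circle packing metric for the pair `I₁`, `I₂` of disjoint sets
of vertices: the curve at `v` is a hypercycle for `v ∈ I₁`, a horocycle for `v ∈ I₂`, and a circle
at all other vertices. -/
structure IsGeneralizedCirclePackingMetric {V : Type*} (I₁ I₂ : Finset V) (k : V → ℝ) : Prop where
  disjoint : Disjoint I₁ I₂
  pos : ∀ v, 0 < k v
  lt_one : ∀ v ∈ I₁, k v < 1
  eq_one : ∀ v ∈ I₂, k v = 1
  one_lt : ∀ v, v ∉ I₁ → v ∉ I₂ → 1 < k v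

/-- The generalized hyperbolic circle packing induced by `k`, face by face: every face `f` is
realized in `ℍ` by three mutually externally tangent circles, horocycles or hypercycles, the one at
the corner `v` having geodesic curvature `k v`. The polygon spanned by the centres (at the corners
with `k v > 1`), ideal centres (`k v = 1`) and axes (`k v < 1`) of the three curves is the face of
the polyhedral surface; by tangency the distance of two centres or axes is the sum of the two
radii, so that faces sharing an edge fit together along it. -/
structure Triangulation.CirclePacking {S : Type*} [TopologicalSpace S] {V : Type*} [Fintype V]
    (T : Triangulation S V) (k : V → ℝ) where
  disc : Finset V → V → Set ℍ
  isGeneralizedDisc : ∀ f ∈ T.faces, ∀ v ∈ f, IsGeneralizedDisc (k v) (disc f v)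
  tangent : ∀ f ∈ T.faces, ∀ v ∈ f, ∀ w ∈ f, v ≠ w → ExternallyTangent (disc f v) (disc f w)

namespace Triangulation.CirclePacking

variable {S : Type*} [TopologicalSpace S] {V : Type*} [Fintype V]
  {T : Triangulation S V} {k : V → ℝ}

/-- The length of the part in the face `f` of the curve at the corner `v`, i.e. of its arc between
the two points where it is tangent to the curves at the other corners `u`, `w` of `f`. (The face
has an angle smaller than `π` at `v`, so that this is the shorter arc if the curve is a circle.
The value does not depend on the order of `u` and `w`.) -/
def faceArcLength (P : T.CirclePacking k) (f : Finset V) (v : V) : ENNReal :=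
  ⨅ (u ∈ f) (w ∈ f) (_ : u ≠ v ∧ w ≠ v ∧ u ≠ w),
    arcLengthBetween (frontier (P.disc f v)) (frontier (P.disc f u)) (frontier (P.disc f w))

/-- The length of the curve of the packing at the vertex `v`, which is made of one arc in each
face around `v`. -/
def circleLength [DecidableEq V] (P : T.CirclePacking k) (v : V) : ℝ :=
  ∑ f ∈ T.faces.filter (fun f => v ∈ f), (P.faceArcLength f v).toReal

/-- The total geodesic curvature at `v`: length times geodesic curvature of the curve at `v`. -/
def totalGeodesicCurvature [DecidableEq V] (P : T.CirclePacking k) (v : V) : ℝ :=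
  P.circleLength v * k v

end Triangulation.CirclePacking

/-- The generalized hyperbolic circle packing metric `k` has total geodesic curvature `L v` at every
vertex `v`. -/
def Triangulation.HasTotalGeodesicCurvature {S : Type*} [TopologicalSpace S] {V : Type*}
    [Fintype V] [DecidableEq V] (T : Triangulation S V) (k L : V → ℝ) : Prop :=
  ∃ P : T.CirclePacking k, ∀ v, P.totalGeodesicCurvature v = L v

end

/-! Write `T` for the hyperbolic tangent of the radius of the circle through the three tangency
points of a face. It satisfies `T ^ 2 = 1 / (1 + σ)`, where `σ` is the sum of the pairwise products
of the curvatures, so it is common to the three corners and decreases in each curvature. The arc at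
a corner of curvature `k` has length `2 ∫₀ᵀ dx / (1 + (k² - 1) x²)`; this one formula covers
circles, horocycles and hypercycles. The proof therefore splits into hyperbolic geometry, which
establishes the formula, and analysis of the map from `k` to the total curvatures on the whole
positive orthant.

Analysis. Integrating by parts and using that the three contact angles at `T` add up to `π / 2`, one
gets Gauss–Bonnet in a face: `π - ∑ faceCurvature` is the integral over `[0, T]` of a nonnegative
function (`pi_sub_sum_faceCurvature`). Raising curvatures lowers this function and shortens the
interval, so the total curvature of a face increases but stays below `π`. At a corner whose own `k`
is kept, the curvature decreases, since only `T` changes. From these two monotonicities follow: -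
necessity, since a face contributes less than `π` to `∑ v ∈ I, L v`, and nothing if it misses `I`; -
uniqueness, by comparing the totals over the set where `k < k'`; - existence, by a Perron argument:
maximize `∑ k` over the `k ≥ ε` with curvatures at most `L`. This set is compact because, where
curvatures tend to infinity on `I` and stay bounded elsewhere, each face meeting `I` contributes
asymptotically at least `π`, which the strict inequality for `I` forbids. At a maximum no inequality
can be strict.

Geometry. A cycle is a vector `(a, b, c, k)` of norm one for the Lorentz form `b² - 4ac + k²`, and
external tangency means that the product of two such vectors is `-1`, so that their sum is isotropic
and represents the tangency point. This gives the distance of tangency points and the existence of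
three tangent cycles. Arcs are parametrized by Möbius transformations preserving the cycle, and
lengths are computed by comparing short chords with the integral above. -/

namespace GeneralizedPacking

open Real Set Filter Topology

/-! ### Arcs of constant geodesic curvature -/

/-- Half of the length of an arc of geodesic curvature `k` with half-angle parameter `T`. -/
noncomputable def arcIntegral (k T : ℝ) : ℝ := ∫ x in (0 : ℝ)..T, 1 / (1 + (k ^ 2 - 1) * x ^ 2)

/-- The angle complementary to half of the one under which the arc of a curve of curvature `k` is
seen from the centre of an orthogonal circle of radius `artanh x`. -/
noncomputable def contactAngle (k x : ℝ) : ℝ := arctan (k * x / √(1 - x ^ 2))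

lemma one_add_mul_sq_pos {k x : ℝ} (h0 : 0 ≤ x) (h1 : x < 1) :
    0 < 1 + (k ^ 2 - 1) * x ^ 2 := by
  nlinarith [sq_nonneg (k * x)]

lemma one_sub_sq_pos {x : ℝ} (h0 : 0 ≤ x) (h1 : x < 1) : 0 < 1 - x ^ 2 := by nlinarith

lemma continuousOn_arcIntegrand (k : ℝ) {T : ℝ} (h1 : T < 1) :
    ContinuousOn (fun x : ℝ => 1 / (1 + (k ^ 2 - 1) * x ^ 2)) (Icc 0 T) := by
  refine ContinuousOn.div (by fun_prop) (by fun_prop) fun x hx => ?_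
  exact (one_add_mul_sq_pos hx.1 (hx.2.trans_lt h1)).ne'

lemma continuousOn_contactAngle (k : ℝ) {T : ℝ} (h1 : T < 1) :
    ContinuousOn (contactAngle k) (Icc 0 T) := by
  refine continuous_arctan.comp_continuousOn (ContinuousOn.div (by fun_prop) (by fun_prop) ?_)
  exact fun x hx => (sqrt_pos.2 (one_sub_sq_pos hx.1 (hx.2.trans_lt h1))).ne'

lemma continuousOn_weight {T : ℝ} (h1 : T < 1) :
    ContinuousOn (fun x : ℝ => x / √(1 - x ^ 2)) (Icc 0 T) := by
  refine ContinuousOn.div (by fun_prop) (by fun_prop) ?_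
  exact fun x hx => (sqrt_pos.2 (one_sub_sq_pos hx.1 (hx.2.trans_lt h1))).ne'

lemma hasDerivAt_sqrt_one_sub_sq {x : ℝ} (h0 : 0 ≤ x) (h1 : x < 1) :
    HasDerivAt (fun x : ℝ => √(1 - x ^ 2)) (-(x / √(1 - x ^ 2))) x := by
  have h := one_sub_sq_pos h0 h1
  refine ((hasDerivAt_pow 2 x).const_sub 1 |>.sqrt h.ne').congr_deriv ?_
  have := sqrt_pos.2 h
  field_simp
  simp

lemma hasDerivAt_contactAngle (k : ℝ) {x : ℝ} (h0 : 0 ≤ x) (h1 : x < 1) :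
    HasDerivAt (contactAngle k) (k / ((1 + (k ^ 2 - 1) * x ^ 2) * √(1 - x ^ 2))) x := by
  have h := one_sub_sq_pos h0 h1
  have hs := sqrt_pos.2 h
  have hq : √(1 - x ^ 2) ^ 2 = 1 - x ^ 2 := sq_sqrt h.le
  have hp := one_add_mul_sq_pos (k := k) h0 h1
  have := (((hasDerivAt_id x).const_mul k).div (hasDerivAt_sqrt_one_sub_sq h0 h1) hs.ne').arctan
  refine this.congr_deriv ?_
  simp only [id_eq, Pi.div_apply]
  set s := √(1 - x ^ 2)
  have h3 : 1 + (k * x / s) ^ 2 = (1 + (k ^ 2 - 1) * x ^ 2) / s ^ 2 := by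
    rw [div_pow, hq]; field_simp; ring
  rw [h3]
  field_simp
  rw [hq]; ring

lemma integral_weight {T : ℝ} (h0 : 0 ≤ T) (h1 : T < 1) :
    ∫ x in (0 : ℝ)..T, x / √(1 - x ^ 2) = 1 - √(1 - T ^ 2) := by
  have h := intervalIntegral.integral_eq_sub_of_hasDerivAt (a := 0) (b := T)
    (f := fun x : ℝ => -√(1 - x ^ 2)) (f' := fun x => x / √(1 - x ^ 2))
    (fun x hx => by
      rw [uIcc_of_le h0] at hx
      exact (hasDerivAt_sqrt_one_sub_sq hx.1 (hx.2.trans_lt h1)).neg.congr_deriv (neg_neg _))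
    ((continuousOn_weight h1).intervalIntegrable_of_Icc h0)
  rw [h]; simp; ring

/-- Integration by parts: the derivative of `√(1 - x²) * contactAngle k x` is the integrand of `k *
arcIntegral k` minus the one on the right. The point is that `k` now enters only through the contact
angle, which is monotone and whose boundary values add up to a constant over a face. -/
lemma mul_arcIntegral (k : ℝ) {T : ℝ} (h0 : 0 ≤ T) (h1 : T < 1) :
    k * arcIntegral k T = √(1 - T ^ 2) * contactAngle k T +
      ∫ x in (0 : ℝ)..T, x / √(1 - x ^ 2) * contactAngle k x := by
  have i1 : IntervalIntegrable (fun x => k * (1 / (1 + (k ^ 2 - 1) * x ^ 2)))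
      MeasureTheory.volume 0 T :=
    ((continuousOn_arcIntegrand k h1).intervalIntegrable_of_Icc h0).const_mul k
  have i2 : IntervalIntegrable (fun x => x / √(1 - x ^ 2) * contactAngle k x)
      MeasureTheory.volume 0 T :=
    ((continuousOn_weight h1).mul (continuousOn_contactAngle k h1)).intervalIntegrable_of_Icc h0
  have h := intervalIntegral.integral_eq_sub_of_hasDerivAt (a := 0) (b := T)
    (f := fun x : ℝ => √(1 - x ^ 2) * contactAngle k x)
    (f' := fun x => k * (1 / (1 + (k ^ 2 - 1) * x ^ 2)) - x / √(1 - x ^ 2) * contactAngle k x)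
    (fun x hx => by
      rw [uIcc_of_le h0] at hx
      have hx1 := hx.2.trans_lt h1
      refine ((hasDerivAt_sqrt_one_sub_sq hx.1 hx1).mul
        (hasDerivAt_contactAngle k hx.1 hx1)).congr_deriv ?_
      have := sqrt_pos.2 (one_sub_sq_pos hx.1 hx1)
      have := one_add_mul_sq_pos (k := k) hx.1 hx1
      field_simp
      ring) (i1.sub i2)
  rw [intervalIntegral.integral_sub i1 i2, intervalIntegral.integral_const_mul] at h
  rw [arcIntegral]
  simp [contactAngle] at h ⊢
  linarith

lemma contactAngle_mono {k k' x x' : ℝ} (hk : 0 ≤ k) (hkk : k ≤ k') (h0 : 0 ≤ x) (hx : x ≤ x')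
    (h1 : x' < 1) : contactAngle k x ≤ contactAngle k' x' := by
  refine arctan_mono (div_le_div₀ ?_ ?_ ?_ ?_)
  · exact mul_nonneg (hk.trans hkk) (h0.trans hx)
  · exact mul_le_mul hkk hx h0 (hk.trans hkk)
  · exact sqrt_pos.2 (one_sub_sq_pos (h0.trans hx) h1)
  · exact sqrt_le_sqrt (by nlinarith)

lemma contactAngle_strictMono_left {k k' x : ℝ} (hkk : k < k') (h0 : 0 < x)
    (h1 : x < 1) : contactAngle k x < contactAngle k' x := by
  have := sqrt_pos.2 (one_sub_sq_pos h0.le h1)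
  exact arctan_strictMono (by gcongr)

lemma contactAngle_strictMono_right {k x x' : ℝ} (hk : 0 < k) (h0 : 0 ≤ x) (hx : x < x')
    (h1 : x' < 1) : contactAngle k x < contactAngle k x' := by
  have h2 := sqrt_pos.2 (one_sub_sq_pos (h0.trans hx.le) h1)
  refine arctan_strictMono (div_lt_div₀ (by gcongr) (sqrt_le_sqrt (by nlinarith)) ?_ h2)
  exact (mul_pos hk (h0.trans_lt hx)).le

lemma contactAngle_nonneg {k x : ℝ} (hk : 0 ≤ k) (h0 : 0 ≤ x) : 0 ≤ contactAngle k x :=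
  arctan_nonneg.2 (div_nonneg (mul_nonneg hk h0) (sqrt_nonneg _))

lemma arcIntegral_mono {k T T' : ℝ} (h0 : 0 ≤ T) (hT : T ≤ T') (h1 : T' < 1) :
    arcIntegral k T ≤ arcIntegral k T' := by
  refine intervalIntegral.integral_mono_interval le_rfl h0 hT ?_
    ((continuousOn_arcIntegrand k h1).intervalIntegrable_of_Icc (h0.trans hT))
  refine (MeasureTheory.ae_restrict_mem measurableSet_Ioc).mono fun x hx => ?_
  exact one_div_nonneg.2 (one_add_mul_sq_pos hx.1.le (hx.2.trans_lt h1)).le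

lemma arcIntegral_pos {k T : ℝ} (h0 : 0 < T) (h1 : T < 1) : 0 < arcIntegral k T := by
  refine intervalIntegral.intervalIntegral_pos_of_pos_on
    ((continuousOn_arcIntegrand k h1).intervalIntegrable_of_Icc h0.le) (fun x hx => ?_) h0
  exact one_div_pos.2 (one_add_mul_sq_pos hx.1.le (hx.2.trans h1))

lemma sqrt_mul_contactAngle_le {k T : ℝ} (hk : 0 ≤ k) (h0 : 0 ≤ T) (h1 : T < 1) :
    √(1 - T ^ 2) * contactAngle k T ≤ k * arcIntegral k T := by
  rw [mul_arcIntegral k h0 h1, le_add_iff_nonneg_right]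
  refine intervalIntegral.integral_nonneg h0 fun x hx => ?_
  exact mul_nonneg (div_nonneg hx.1 (sqrt_nonneg _)) (contactAngle_nonneg hk hx.1)

/-! ### A face of the packing -/

section Face

variable {V : Type*}

/-- The sum of the products of two curvatures at different corners of `f`. -/
noncomputable def pairSum (k : V → ℝ) (f : Finset V) : ℝ :=
  ((∑ v ∈ f, k v) ^ 2 - ∑ v ∈ f, k v ^ 2) / 2

/-- The hyperbolic tangent of the radius of the circle through the three tangency points. -/
noncomputable def inTanh (k : V → ℝ) (f : Finset V) : ℝ := 1 / √(1 + pairSum k f)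

/-- The total geodesic curvature of the arc at the corner `v` in the face `f`. -/
noncomputable def faceCurvature (k : V → ℝ) (f : Finset V) (v : V) : ℝ :=
  2 * (k v * arcIntegral (k v) (inTanh k f))

lemma pairSum_triple [DecidableEq V] (k : V → ℝ) {u v w : V} (h1 : u ≠ v) (h2 : u ≠ w)
    (h3 : v ≠ w) : pairSum k {u, v, w} = k u * k v + k u * k w + k v * k w := by
  have e : ∀ g : V → ℝ, ∑ x ∈ ({u, v, w} : Finset V), g x = g u + g v + g w := fun g => by
    rw [Finset.sum_insert (by simp [h1, h2]), Finset.sum_insert (by simp [h3]),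
      Finset.sum_singleton, add_assoc]
  rw [pairSum, e, e]; ring

lemma pairSum_pos {k : V → ℝ} {f : Finset V} (hf : f.card = 3) (hk : ∀ v ∈ f, 0 < k v) :
    0 < pairSum k f := by
  classical
  obtain ⟨u, v, w, h1, h2, h3, rfl⟩ := Finset.card_eq_three.1 hf
  rw [pairSum_triple k h1 h2 h3]
  have := hk u (by simp); have := hk v (by simp); have := hk w (by simp)
  positivity

lemma pairSum_mono {k k' : V → ℝ} {f : Finset V} (hf : f.card = 3) (hk : ∀ v ∈ f, 0 < k v)
    (hkk : ∀ v ∈ f, k v ≤ k' v) : pairSum k f ≤ pairSum k' f := by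
  classical
  obtain ⟨u, v, w, h1, h2, h3, rfl⟩ := Finset.card_eq_three.1 hf
  rw [pairSum_triple k h1 h2 h3, pairSum_triple k' h1 h2 h3]
  have a := hk u (by simp); have b := hk v (by simp); have c := hk w (by simp)
  have a' := hkk u (by simp); have b' := hkk v (by simp); have c' := hkk w (by simp)
  have := a.trans_le a'; have := b.trans_le b'; have := c.trans_le c'
  gcongr

lemma inTanh_pos {k : V → ℝ} {f : Finset V} (hf : f.card = 3) (hk : ∀ v ∈ f, 0 < k v) :
    0 < inTanh k f :=
  one_div_pos.2 (sqrt_pos.2 (by linarith [pairSum_pos hf hk]))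

lemma inTanh_sq {k : V → ℝ} {f : Finset V} (hf : f.card = 3) (hk : ∀ v ∈ f, 0 < k v) :
    inTanh k f ^ 2 = 1 / (1 + pairSum k f) := by
  rw [inTanh, div_pow, sq_sqrt (by linarith [pairSum_pos hf hk]), one_pow]

lemma inTanh_lt_one {k : V → ℝ} {f : Finset V} (hf : f.card = 3) (hk : ∀ v ∈ f, 0 < k v) :
    inTanh k f < 1 := by
  have h := pairSum_pos hf hk
  have : inTanh k f ^ 2 < 1 := by
    rw [inTanh_sq hf hk, div_lt_one (by linarith)]; linarith
  nlinarith [inTanh_pos hf hk]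

lemma inTanh_anti {k k' : V → ℝ} {f : Finset V} (hf : f.card = 3) (hk : ∀ v ∈ f, 0 < k v)
    (hkk : ∀ v ∈ f, k v ≤ k' v) : inTanh k' f ≤ inTanh k f := by
  have h := pairSum_pos hf hk
  exact one_div_le_one_div_of_le (sqrt_pos.2 (by linarith))
    (sqrt_le_sqrt (by linarith [pairSum_mono hf hk hkk]))

lemma inTanh_div_sqrt {k : V → ℝ} {f : Finset V} (hf : f.card = 3) (hk : ∀ v ∈ f, 0 < k v) :
    inTanh k f / √(1 - inTanh k f ^ 2) = 1 / √(pairSum k f) := by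
  have h := pairSum_pos hf hk
  have h1 : 1 - inTanh k f ^ 2 = pairSum k f / (1 + pairSum k f) := by
    rw [inTanh_sq hf hk]; field_simp; ring
  rw [h1, sqrt_div h.le, inTanh]
  have := sqrt_pos.2 h
  have := sqrt_pos.2 (show 0 < 1 + pairSum k f by linarith)
  field_simp

/-- Seen from the centre of the circle through the tangency points, the three arcs fill the full
angle `2π`. In formulas, the tangents of the angles are `k v / √σ` with `σ = pairSum k f`, and the
addition theorem turns the sum of two of them into the complement of the third. -/
lemma sum_contactAngle {k : V → ℝ} {f : Finset V} (hf : f.card = 3) (hk : ∀ v ∈ f, 0 < k v) :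
    ∑ v ∈ f, contactAngle (k v) (inTanh k f) = π / 2 := by
  classical
  have e : ∀ v, contactAngle (k v) (inTanh k f) = arctan (k v / √(pairSum k f)) := fun v => by
    rw [contactAngle, mul_div_assoc, inTanh_div_sqrt hf hk, mul_one_div]
  simp only [e]
  have hp := pairSum_pos hf hk
  obtain ⟨u, v, w, h1, h2, h3, rfl⟩ := Finset.card_eq_three.1 hf
  have hs := sqrt_pos.2 hp
  have hq := sq_sqrt hp.le
  rw [Finset.sum_insert (by simp [h1, h2]), Finset.sum_insert (by simp [h3]),
      Finset.sum_singleton]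
  rw [pairSum_triple k h1 h2 h3] at *
  have a := hk u (by simp); have b := hk v (by simp); have c := hk w (by simp)
  set s := √(k u * k v + k u * k w + k v * k w)
  have hlt : k u / s * (k v / s) < 1 := by
    rw [div_mul_div_comm, ← sq, hq, div_lt_one hp]
    nlinarith [mul_pos a c, mul_pos b c]
  rw [← add_assoc, arctan_add hlt]
  have : (k u / s + k v / s) / (1 - k u / s * (k v / s)) = (k w / s)⁻¹ := by
    have h4 : 1 - k u / s * (k v / s) = (k u * k w + k v * k w) / s ^ 2 := by
      rw [div_mul_div_comm, ← sq, hq]; field_simp; ring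
    rw [h4]
    have : 0 < k u * k w + k v * k w := by positivity
    field_simp
  rw [this, arctan_inv_of_pos (by positivity)]
  ring

/-- The integrand of the area of the region enclosed by the three curves of a face. -/
noncomputable def areaIntegrand (k : V → ℝ) (f : Finset V) (x : ℝ) : ℝ :=
  x / √(1 - x ^ 2) * (π - 2 * ∑ v ∈ f, contactAngle (k v) x)

lemma continuousOn_areaIntegrand (k : V → ℝ) (f : Finset V) {T : ℝ} (h1 : T < 1) :
    ContinuousOn (areaIntegrand k f) (Icc 0 T) :=
  (continuousOn_weight h1).mul (continuousOn_const.sub (continuousOn_const.mul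
    (continuousOn_finsetSum _ fun v _ => continuousOn_contactAngle (k v) h1)))

lemma areaIntegrand_nonneg {k : V → ℝ} {f : Finset V} (hf : f.card = 3)
    (hk : ∀ v ∈ f, 0 < k v) {x : ℝ} (hx : x ∈ Icc 0 (inTanh k f)) : 0 ≤ areaIntegrand k f x := by
  refine mul_nonneg (div_nonneg hx.1 (sqrt_nonneg _)) ?_
  have : ∑ v ∈ f, contactAngle (k v) x ≤ π / 2 := by
    rw [← sum_contactAngle hf hk]
    exact Finset.sum_le_sum fun v hv =>
      contactAngle_mono (hk v hv).le le_rfl hx.1 hx.2 (inTanh_lt_one hf hk)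
  linarith

/-- The Gauss–Bonnet formula for the region enclosed by the three curves of a face. -/
lemma pi_sub_sum_faceCurvature {k : V → ℝ} {f : Finset V} (hf : f.card = 3)
    (hk : ∀ v ∈ f, 0 < k v) :
    π - ∑ v ∈ f, faceCurvature k f v = ∫ x in (0 : ℝ)..inTanh k f, areaIntegrand k f x := by
  have h0 := (inTanh_pos hf hk).le
  have h1 := inTanh_lt_one hf hk
  have hs := sum_contactAngle hf hk
  set T := inTanh k f with hT
  have i1 := (continuousOn_weight h1).intervalIntegrable_of_Icc (μ := MeasureTheory.volume) h0
  have i2 : ∀ v ∈ f, IntervalIntegrable (fun x => x / √(1 - x ^ 2) * contactAngle (k v) x)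
      MeasureTheory.volume 0 T := fun v _ =>
    ((continuousOn_weight h1).mul (continuousOn_contactAngle (k v) h1)).intervalIntegrable_of_Icc h0
  have e : areaIntegrand k f = fun x => π * (x / √(1 - x ^ 2)) -
      2 * ∑ v ∈ f, x / √(1 - x ^ 2) * contactAngle (k v) x := by
    ext x; rw [areaIntegrand, ← Finset.mul_sum]; ring
  have i3 : IntervalIntegrable
      (fun x => ∑ v ∈ f, x / √(1 - x ^ 2) * contactAngle (k v) x) MeasureTheory.volume 0 T := by
    have := IntervalIntegrable.sum f i2
    simpa only [Finset.sum_fn] using this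
  rw [e, intervalIntegral.integral_sub (i1.const_mul π) (i3.const_mul 2),
    intervalIntegral.integral_const_mul, intervalIntegral.integral_const_mul,
    integral_weight h0 h1, intervalIntegral.integral_finsetSum i2]
  -- The boundary terms add up to `π * √(1 - T²)`, which together with `π` makes `π` times the
  -- integral of the weight.
  simp only [faceCurvature, ← hT, mul_arcIntegral _ h0 h1]
  rw [← Finset.mul_sum, Finset.sum_add_distrib, ← Finset.mul_sum, hs]
  ring

/-- The contact angles reach the sum `π / 2` only at the upper endpoint; before it the area
integrand is strictly positive. -/
lemma sum_faceCurvature_lt_pi {k : V → ℝ} {f : Finset V} (hf : f.card = 3)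
    (hk : ∀ v ∈ f, 0 < k v) : ∑ v ∈ f, faceCurvature k f v < π := by
  have h0 := inTanh_pos hf hk
  have h1 := inTanh_lt_one hf hk
  have : 0 < ∫ x in (0 : ℝ)..inTanh k f, areaIntegrand k f x := by
    refine intervalIntegral.intervalIntegral_pos_of_pos_on
      ((continuousOn_areaIntegrand k f h1).intervalIntegrable_of_Icc h0.le) (fun x hx => ?_) h0
    refine mul_pos (div_pos hx.1 (sqrt_pos.2 (one_sub_sq_pos hx.1.le (hx.2.trans h1)))) ?_
    have : ∑ v ∈ f, contactAngle (k v) x < π / 2 := by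
      rw [← sum_contactAngle hf hk]
      exact Finset.sum_lt_sum_of_nonempty (Finset.card_pos.1 (by omega)) fun v hv =>
        contactAngle_strictMono_right (hk v hv) hx.1.le hx.2 h1
    linarith
  linarith [pi_sub_sum_faceCurvature hf hk]

/-- Larger curvatures have larger contact angles and a smaller `inTanh`. Hence the area integrand
drops, and so does its interval of integration, on whose lost part the old integrand is nonnegative.
Strictness is witnessed at the new endpoint. -/
lemma sum_faceCurvature_mono {k k' : V → ℝ} {f : Finset V} (hf : f.card = 3)
    (hk : ∀ v ∈ f, 0 < k v) (hkk : ∀ v ∈ f, k v ≤ k' v) :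
    ∑ v ∈ f, faceCurvature k f v ≤ ∑ v ∈ f, faceCurvature k' f v ∧
    ((∃ v ∈ f, k v < k' v) → ∑ v ∈ f, faceCurvature k f v < ∑ v ∈ f, faceCurvature k' f v) := by
  have hk' : ∀ v ∈ f, 0 < k' v := fun v hv => (hk v hv).trans_le (hkk v hv)
  have h0 := inTanh_pos hf hk'
  have h1 := inTanh_lt_one hf hk'
  have hT := inTanh_anti hf hk hkk
  have hT1 := inTanh_lt_one hf hk
  have e := pi_sub_sum_faceCurvature hf hk
  have e' := pi_sub_sum_faceCurvature hf hk'
  have c := continuousOn_areaIntegrand k f h1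
  have c' := continuousOn_areaIntegrand k' f h1
  have hle : ∀ x ∈ Icc 0 (inTanh k' f), areaIntegrand k' f x ≤ areaIntegrand k f x := by
    intro x hx
    refine mul_le_mul_of_nonneg_left ?_ (div_nonneg hx.1 (sqrt_nonneg _))
    gcongr with v hv
    exact contactAngle_mono (hk v hv).le (hkk v hv) hx.1 le_rfl (hx.2.trans_lt h1)
  have h2 : ∫ x in (0 : ℝ)..inTanh k' f, areaIntegrand k f x ≤
      ∫ x in (0 : ℝ)..inTanh k f, areaIntegrand k f x := by
    refine intervalIntegral.integral_mono_interval (μ := MeasureTheory.volume) le_rfl h0.le hT ?_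
      ((continuousOn_areaIntegrand k f hT1).intervalIntegrable_of_Icc (h0.le.trans hT))
    refine (MeasureTheory.ae_restrict_mem measurableSet_Ioc).mono fun x hx => ?_
    exact areaIntegrand_nonneg hf hk ⟨hx.1.le, hx.2⟩
  refine ⟨?_, fun ⟨v, hv, hlt⟩ => ?_⟩
  · have := intervalIntegral.integral_mono_on (μ := MeasureTheory.volume) h0.le (c'.intervalIntegrable_of_Icc h0.le)
      (c.intervalIntegrable_of_Icc h0.le) hle
    linarith
  · have := intervalIntegral.integral_lt_integral_of_continuousOn_of_le_of_exists_lt h0 c' c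
      (fun x hx => hle x ⟨hx.1.le, hx.2⟩) ⟨inTanh k' f, ⟨h0.le, le_rfl⟩, ?_⟩
    · linarith
    · refine mul_lt_mul_of_pos_left ?_ (div_pos h0 (sqrt_pos.2 (one_sub_sq_pos h0.le h1)))
      have := Finset.sum_lt_sum (s := f) (f := fun v => contactAngle (k v) (inTanh k' f))
        (g := fun v => contactAngle (k' v) (inTanh k' f))
        (fun v hv => contactAngle_mono (hk v hv).le (hkk v hv) h0.le le_rfl h1)
        ⟨v, hv, contactAngle_strictMono_left hlt h0 h1⟩
      linarith

lemma faceCurvature_pos {k : V → ℝ} {f : Finset V} (hf : f.card = 3)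
    (hk : ∀ v ∈ f, 0 < k v) {v : V} (hv : v ∈ f) : 0 < faceCurvature k f v :=
  mul_pos two_pos (mul_pos (hk v hv) (arcIntegral_pos (inTanh_pos hf hk) (inTanh_lt_one hf hk)))

lemma faceCurvature_anti {k k' : V → ℝ} {f : Finset V} (hf : f.card = 3)
    (hk : ∀ v ∈ f, 0 < k v) (hkk : ∀ v ∈ f, k v ≤ k' v) {v : V} (hv : v ∈ f) (h : k v = k' v) :
    faceCurvature k' f v ≤ faceCurvature k f v := by
  have hk' : ∀ v ∈ f, 0 < k' v := fun v hv => (hk v hv).trans_le (hkk v hv)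
  rw [faceCurvature, faceCurvature, ← h]
  have := arcIntegral_mono (k := k v) (inTanh_pos hf hk').le (inTanh_anti hf hk hkk)
    (inTanh_lt_one hf hk)
  have := hk v hv
  gcongr

/-- The part of the total curvature of a face at the corners in `I` increases when the curvatures
in `I` increase and the other ones decrease. -/
lemma sum_inter_faceCurvature_mono [DecidableEq V] {k k' : V → ℝ} {f : Finset V} (hf : f.card = 3)
    (hk : ∀ v ∈ f, 0 < k v) (hk' : ∀ v ∈ f, 0 < k' v) {I : Finset V}
    (hI : ∀ v ∈ f, v ∈ I → k v ≤ k' v) (hJ : ∀ v ∈ f, v ∉ I → k' v ≤ k v) :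
    ∑ v ∈ f ∩ I, faceCurvature k f v ≤ ∑ v ∈ f ∩ I, faceCurvature k' f v ∧
    ((∃ v ∈ f ∩ I, k v < k' v) →
      ∑ v ∈ f ∩ I, faceCurvature k f v < ∑ v ∈ f ∩ I, faceCurvature k' f v) := by
  -- Pass through `m`, the larger of `k` and `k'` on `f`. From `k` to `m` the total over `f` grows
  -- while the terms off `I` shrink, so the part in `I` grows. From `m` to `k'` only curvatures off
  -- `I` are lowered, which raises the terms in `I`.
  set m : V → ℝ := fun v => if v ∈ I then k' v else k v with hm
  have mI : ∀ v ∈ I, m v = k' v := fun v hv => by simp [hm, hv]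
  have mJ : ∀ v ∉ I, m v = k v := fun v hv => by simp [hm, hv]
  have hm0 : ∀ v ∈ f, 0 < m v := fun v hv => by
    by_cases h : v ∈ I
    · rw [mI v h]; exact hk' v hv
    · rw [mJ v h]; exact hk v hv
  have hkm : ∀ v ∈ f, k v ≤ m v := fun v hv => by
    by_cases h : v ∈ I
    · rw [mI v h]; exact hI v hv h
    · rw [mJ v h]
  have hkm' : ∀ v ∈ f, k' v ≤ m v := fun v hv => by
    by_cases h : v ∈ I
    · rw [mI v h]
    · rw [mJ v h]; exact hJ v hv h
  have s1 := sum_faceCurvature_mono hf hk hkm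
  have s2 : ∑ v ∈ f \ I, faceCurvature m f v ≤ ∑ v ∈ f \ I, faceCurvature k f v :=
    Finset.sum_le_sum fun v hv => by
      rw [Finset.mem_sdiff] at hv
      exact faceCurvature_anti hf hk hkm hv.1 (mJ v hv.2).symm
  have s3 : ∑ v ∈ f ∩ I, faceCurvature m f v ≤ ∑ v ∈ f ∩ I, faceCurvature k' f v :=
    Finset.sum_le_sum fun v hv => by
      rw [Finset.mem_inter] at hv
      exact faceCurvature_anti hf hk' hkm' hv.1 (mI v hv.2).symm
  have d1 := Finset.sum_inter_add_sum_sdiff f I (faceCurvature k f)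
  have d2 := Finset.sum_inter_add_sum_sdiff f I (faceCurvature m f)
  refine ⟨by linarith [s1.1], fun ⟨v, hv, hlt⟩ => ?_⟩
  rw [Finset.mem_inter] at hv
  have := s1.2 ⟨v, hv.1, by rwa [mI v hv.2]⟩
  linarith

end Face

/-! ### Prescribing total geodesic curvatures -/

section Prescribed

variable {V : Type*} [DecidableEq V]

/-- The sum of the total geodesic curvatures of the arcs at `v` in the faces in `F`. -/
noncomputable def vertexCurvature (F : Finset (Finset V)) (k : V → ℝ) (v : V) : ℝ :=
  ∑ f ∈ F.filter (fun f => v ∈ f), faceCurvature k f v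

lemma sum_vertexCurvature (F : Finset (Finset V)) (k : V → ℝ) (I : Finset V) :
    ∑ v ∈ I, vertexCurvature F k v =
      ∑ f ∈ F.filter (fun f => ∃ v ∈ f, v ∈ I), ∑ v ∈ f ∩ I, faceCurvature k f v := by
  refine Finset.sum_comm' fun v f => ?_
  simp only [Finset.mem_filter, Finset.mem_inter]
  exact ⟨fun ⟨h1, h2, h3⟩ => ⟨⟨h3, h1⟩, h2, v, h3, h1⟩, fun ⟨⟨h1, h2⟩, h3, _⟩ => ⟨h2, h3, h1⟩⟩

variable {F : Finset (Finset V)} (hF : ∀ f ∈ F, f.card = 3) (hV : ∀ v : V, ∃ f ∈ F, v ∈ f)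

include hF in
lemma vertexCurvature_anti {k k' : V → ℝ} (hk : ∀ v, 0 < k v) (hkk : ∀ v, k v ≤ k' v) {v : V}
    (h : k v = k' v) : vertexCurvature F k' v ≤ vertexCurvature F k v :=
  Finset.sum_le_sum fun f hf => by
    rw [Finset.mem_filter] at hf
    exact faceCurvature_anti (hF f hf.1) (fun v _ => hk v) (fun v _ => hkk v) hf.2 h

include hF hV in
lemma vertexCurvature_pos {k : V → ℝ} (hk : ∀ v, 0 < k v) (v : V) :
    0 < vertexCurvature F k v := by
  obtain ⟨f, hf, hv⟩ := hV v
  refine Finset.sum_pos (fun f hf => ?_) ⟨f, Finset.mem_filter.2 ⟨hf, hv⟩⟩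
  rw [Finset.mem_filter] at hf
  exact faceCurvature_pos (hF f hf.1) (fun v _ => hk v) hf.2

include hF hV in
lemma sum_vertexCurvature_lt {k : V → ℝ} (hk : ∀ v, 0 < k v) {I : Finset V} (hI : I.Nonempty) :
    ∑ v ∈ I, vertexCurvature F k v < π * (F.filter (fun f => ∃ v ∈ f, v ∈ I)).card := by
  rw [sum_vertexCurvature, mul_comm, ← nsmul_eq_mul]
  obtain ⟨w, hw⟩ := hI
  obtain ⟨g, hg, hwg⟩ := hV w
  have key : ∀ f ∈ F, ∑ v ∈ f ∩ I, faceCurvature k f v < π := fun f hf =>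
    (Finset.sum_le_sum_of_subset_of_nonneg Finset.inter_subset_left
      fun v hv _ => (faceCurvature_pos (hF f hf) (fun v _ => hk v) hv).le).trans_lt
      (sum_faceCurvature_lt_pi (hF f hf) fun v _ => hk v)
  rw [← Finset.sum_const]
  exact Finset.sum_lt_sum_of_nonempty ⟨g, Finset.mem_filter.2 ⟨hg, w, hwg, hw⟩⟩
    fun f hf => key f (Finset.mem_filter.1 hf).1

include hF hV in
-- On the set `I` where `k < k'`, passing from `k` to `k'` raises curvatures in `I` and does not
-- raise them elsewhere. If `I` were nonempty, the total over `I` would strictly increase.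
lemma le_of_vertexCurvature_eq [Fintype V] {k k' : V → ℝ} (hk : ∀ v, 0 < k v)
    (hk' : ∀ v, 0 < k' v) (h : ∀ v, vertexCurvature F k v = vertexCurvature F k' v) (w : V) :
    k' w ≤ k w := by
  by_contra! hw
  set I : Finset V := Finset.univ.filter fun v => k v < k' v
  have hI : ∀ v, v ∈ I ↔ k v < k' v := fun v => by simp [I]
  obtain ⟨g, hg, hwg⟩ := hV w
  have key := fun f (hf : f ∈ F) => sum_inter_faceCurvature_mono (hF f hf) (fun v _ => hk v)
    (fun v _ => hk' v) (I := I) (fun v _ hv => ((hI v).1 hv).le)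
    (fun v _ hv => not_lt.1 (mt (hI v).2 hv))
  have hlt : ∑ v ∈ I, vertexCurvature F k v < ∑ v ∈ I, vertexCurvature F k' v := by
    rw [sum_vertexCurvature, sum_vertexCurvature]
    refine Finset.sum_lt_sum (fun f hf => (key f (Finset.mem_filter.1 hf).1).1)
      ⟨g, Finset.mem_filter.2 ⟨hg, w, hwg, (hI w).2 hw⟩, (key g hg).2 ⟨w, ?_, hw⟩⟩
    exact Finset.mem_inter.2 ⟨hwg, (hI w).2 hw⟩
  exact hlt.ne (Finset.sum_congr rfl fun v _ => h v)

include hF hV in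
/-- The curvatures of the packing are determined by the total geodesic curvatures. -/
theorem vertexCurvature_injective [Fintype V] {k k' : V → ℝ} (hk : ∀ v, 0 < k v)
    (hk' : ∀ v, 0 < k' v) (h : ∀ v, vertexCurvature F k v = vertexCurvature F k' v) : k = k' :=
  funext fun v => le_antisymm (le_of_vertexCurvature_eq hF hV hk' hk (fun v => (h v).symm) v)
    (le_of_vertexCurvature_eq hF hV hk hk' h v)

/-! ### Continuity, and limits for curvatures tending to zero or infinity -/

omit [DecidableEq V] in
lemma continuous_faceCurvature {f : Finset V} (hf : f.card = 3) (v : V) :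
    Continuous fun k : {k : V → ℝ // ∀ v, 0 < k v} => faceCurvature k.1 f v := by
  have hc : ∀ v, Continuous fun k : {k : V → ℝ // ∀ v, 0 < k v} => k.1 v := fun v =>
    (continuous_apply v).comp continuous_subtype_val
  have hp : Continuous fun k : {k : V → ℝ // ∀ v, 0 < k v} => pairSum k.1 f := by
    exact (((continuous_finsetSum _ fun v _ => hc v).pow 2).sub
      (continuous_finsetSum _ fun v _ => (hc v).pow 2)).div_const 2
  have hT : Continuous fun k : {k : V → ℝ // ∀ v, 0 < k v} => inTanh k.1 f := by
    refine continuous_const.div (by fun_prop) fun k => (sqrt_pos.2 ?_).ne'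
    linarith [pairSum_pos hf fun v _ => k.2 v]
  refine continuous_const.mul ((hc v).mul ?_)
  -- Truncating `x²` at `T²` does not change the integral but makes the integrand continuous for all
  -- real `x`, as the theorem on parametric integrals requires.
  have e : ∀ k : {k : V → ℝ // ∀ v, 0 < k v}, arcIntegral (k.1 v) (inTanh k.1 f) =
      ∫ x in (0 : ℝ)..inTanh k.1 f, 1 / (1 + (k.1 v ^ 2 - 1) * min (x ^ 2) (inTanh k.1 f ^ 2)) := by
    intro k
    have h0 := inTanh_pos hf fun v _ => k.2 v
    refine intervalIntegral.integral_congr fun x hx => ?_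
    rw [uIcc_of_le h0.le] at hx
    rw [min_eq_left (pow_le_pow_left₀ hx.1 hx.2 2)]
  simp only [e]
  refine intervalIntegral.continuous_parametric_intervalIntegral_of_continuous ?_ hT
  refine Continuous.div continuous_const ?_ ?_
  · have := (hc v).comp (continuous_fst (X := {k : V → ℝ // ∀ v, 0 < k v}) (Y := ℝ))
    have := hT.comp (continuous_fst (X := {k : V → ℝ // ∀ v, 0 < k v}) (Y := ℝ))
    simp only [Function.comp_def] at *
    fun_prop
  · rintro ⟨k, x⟩
    have h0 := inTanh_pos hf fun v _ => k.2 v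
    have h1 := inTanh_lt_one hf fun v _ => k.2 v
    have a : 0 ≤ min (x ^ 2) (inTanh k.1 f ^ 2) := le_min (sq_nonneg _) (sq_nonneg _)
    have b : min (x ^ 2) (inTanh k.1 f ^ 2) < 1 := (min_le_right _ _).trans_lt (by nlinarith)
    have := mul_nonneg (sq_nonneg (k.1 v)) a
    simp only
    nlinarith

include hF in
lemma continuousOn_vertexCurvature (v : V) :
    ContinuousOn (fun k => vertexCurvature F k v) {k : V → ℝ | ∀ v, 0 < k v} := by
  refine continuousOn_finsetSum _ fun f hf => ?_
  rw [continuousOn_iff_continuous_domRestrict]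
  exact continuous_faceCurvature (hF f (Finset.mem_filter.1 hf).1) v

lemma arcIntegral_le_neg_log {k T : ℝ} (h0 : 0 ≤ T) (h1 : T < 1) :
    arcIntegral k T ≤ -log (1 - T) := by
  have hd : ∀ x ∈ uIcc 0 T, HasDerivAt (fun x => -log (1 - x)) (1 / (1 - x)) x := fun x hx => by
    rw [uIcc_of_le h0] at hx
    have : 1 - x ≠ 0 := by linarith [hx.2]
    refine (((hasDerivAt_id x).const_sub 1).log this).neg.congr_deriv ?_
    simp [neg_div]
  have hc : ContinuousOn (fun x : ℝ => 1 / (1 - x)) (Icc 0 T) :=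
    ContinuousOn.div (by fun_prop) (by fun_prop) fun x hx => by linarith [hx.2]
  have i := hc.intervalIntegrable_of_Icc (μ := MeasureTheory.volume) h0
  have h := intervalIntegral.integral_eq_sub_of_hasDerivAt hd i
  have h2 := intervalIntegral.integral_mono_on (μ := MeasureTheory.volume) h0
    ((continuousOn_arcIntegrand k h1).intervalIntegrable_of_Icc h0) i fun x hx =>
      one_div_le_one_div_of_le (by linarith [hx.2]) (by
        nlinarith [mul_nonneg (sq_nonneg k) (sq_nonneg x), mul_nonneg hx.1 (sub_nonneg.2 (hx.2.trans h1.le))]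
          : 1 - x ≤ 1 + (k ^ 2 - 1) * x ^ 2)
  rw [h] at h2
  simpa [arcIntegral] using h2

omit [DecidableEq V] in
-- As `ε → 0`, `inTanh` tends to one and the bound on the arc length diverges, but only like `log (1
-- / (1 - T))` with `1 - T` of order `ε²`. The factor `ε` outweighs this logarithm.
lemma tendsto_faceCurvature_const {f : Finset V} (hf : f.card = 3) (v : V) :
    Tendsto (fun ε : ℝ => faceCurvature (fun _ => ε) f v) (𝓝[>] 0) (𝓝 0) := by
  have hc : Continuous fun ε : ℝ =>
      2 * (ε * log (2 * (1 + 3 * ε ^ 2) / 3) - 2 * (ε * log ε)) := by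
    refine continuous_const.mul ((continuous_id.mul (Continuous.log (by fun_prop)
      fun ε => by positivity)).sub (continuous_const.mul continuous_mul_log))
  have h := (hc.tendsto 0).mono_left (nhdsWithin_le_nhds (s := Ioi 0))
  simp only [zero_mul, mul_zero, sub_zero] at h
  refine tendsto_of_tendsto_of_tendsto_of_le_of_le' tendsto_const_nhds h ?_ ?_
  · filter_upwards [self_mem_nhdsWithin] with ε (hε : 0 < ε)
    exact mul_nonneg two_pos.le (mul_nonneg hε.le (arcIntegral_pos (inTanh_pos hf fun _ _ => hε)
      (inTanh_lt_one hf fun _ _ => hε)).le)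
  · filter_upwards [self_mem_nhdsWithin] with ε (hε : 0 < ε)
    have h0 := inTanh_pos hf (k := fun _ => ε) fun _ _ => hε
    have h1 := inTanh_lt_one hf (k := fun _ => ε) fun _ _ => hε
    have h2 := inTanh_sq hf (k := fun _ => ε) fun _ _ => hε
    have h3 : pairSum (fun _ => ε) f = 3 * ε ^ 2 := by
      simp [pairSum, hf]; ring
    have h4 := arcIntegral_le_neg_log (k := ε) h0.le h1
    set T := inTanh (fun _ : V => ε) f with hT
    -- From `1 - T² = (1 - T)(1 + T) ≤ 2 (1 - T)`.
    have h5 : 3 * ε ^ 2 / (2 * (1 + 3 * ε ^ 2)) ≤ 1 - T := by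
      have : 1 - T ^ 2 = 3 * ε ^ 2 / (1 + 3 * ε ^ 2) := by
        rw [h2, h3]; field_simp; ring
      have e : 3 * ε ^ 2 / (2 * (1 + 3 * ε ^ 2)) = (1 - T ^ 2) / 2 := by rw [this]; field_simp
      rw [e]; nlinarith
    have h6 := log_le_log (by positivity) h5
    have h7 : log (3 * ε ^ 2 / (2 * (1 + 3 * ε ^ 2))) =
        2 * log ε - log (2 * (1 + 3 * ε ^ 2) / 3) := by
      have : 3 * ε ^ 2 / (2 * (1 + 3 * ε ^ 2)) = ε ^ 2 / (2 * (1 + 3 * ε ^ 2) / 3) := by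
        field_simp
      rw [this, log_div (by positivity) (by positivity), log_pow]; norm_cast
    have h8 : arcIntegral ε T ≤ log (2 * (1 + 3 * ε ^ 2) / 3) - 2 * log ε := by linarith
    have := mul_le_mul_of_nonneg_left h8 hε.le
    rw [faceCurvature, ← hT]
    linarith

include hF in
lemma tendsto_vertexCurvature_const (v : V) :
    Tendsto (fun ε : ℝ => vertexCurvature F (fun _ => ε) v) (𝓝[>] 0) (𝓝 0) := by
  have := tendsto_finsetSum (F.filter fun f => v ∈ f) (fun f hf =>
    tendsto_faceCurvature_const (hF f (Finset.mem_filter.1 hf).1) v)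
  simpa [vertexCurvature] using this

omit [DecidableEq V] in
-- A curvature tending to infinity is multiplied in `pairSum` by another one, which is at least `ε`.
lemma tendsto_inTanh {ι : Type*} {l : Filter ι} {k : ι → V → ℝ} {ε : ℝ} (hε : 0 < ε)
    (hk : ∀ n v, ε ≤ k n v) {f : Finset V} (hf : f.card = 3) {v : V} (hv : v ∈ f)
    (h : Tendsto (fun n => k n v) l atTop) : Tendsto (fun n => inTanh (k n) f) l (𝓝 0) := by
  classical
  have hp : ∀ n, ε * k n v ≤ pairSum (k n) f := fun n => by
    have h0 : ∀ v, 0 < k n v := fun v => hε.trans_le (hk n v)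
    obtain ⟨a, b, c, h1, h2, h3, rfl⟩ := Finset.card_eq_three.1 hf
    rw [pairSum_triple _ h1 h2 h3]
    have := mul_pos (h0 a) (h0 b); have := mul_pos (h0 a) (h0 c); have := mul_pos (h0 b) (h0 c)
    simp only [Finset.mem_insert, Finset.mem_singleton] at hv
    rcases hv with rfl | rfl | rfl
    · nlinarith [mul_le_mul_of_nonneg_right (hk n b) (h0 v).le]
    · nlinarith [mul_le_mul_of_nonneg_right (hk n a) (h0 v).le]
    · nlinarith [mul_le_mul_of_nonneg_right (hk n a) (h0 v).le]
  have h1 : Tendsto (fun n => 1 + pairSum (k n) f) l atTop :=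
    tendsto_atTop_add_const_left _ _ (tendsto_atTop_mono hp (h.const_mul_atTop hε))
  simpa [inTanh, Function.comp_def] using
    tendsto_inv_atTop_zero.comp (tendsto_sqrt_atTop.comp h1)

/-- If some curvatures in a face tend to infinity and the other ones remain bounded, then the total
geodesic curvature of the arcs of the former is asymptotically at least `π`. -/
lemma exists_tendsto_pi_le_sum_faceCurvature {ι : Type*} {l : Filter ι} {k : ι → V → ℝ} {ε : ℝ}
    (hε : 0 < ε) (hk : ∀ n v, ε ≤ k n v) {f : Finset V} (hf : f.card = 3) {I : Finset V}
    (hI : ∀ v ∈ I, Tendsto (fun n => k n v) l atTop)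
    (hJ : ∀ v ∉ I, ∃ M, ∀ᶠ n in l, k n v ≤ M) (hfI : ∃ v ∈ f, v ∈ I) :
    ∃ g : ι → ℝ, Tendsto g l (𝓝 π) ∧ ∀ n, g n ≤ ∑ v ∈ f ∩ I, faceCurvature (k n) f v := by
  obtain ⟨w, hwf, hwI⟩ := hfI
  have hT := tendsto_inTanh hε hk hf hwf (hI w hwI)
  have h0 : ∀ n v, 0 < k n v := fun n v => hε.trans_le (hk n v)
  have hs : Tendsto (fun n => √(1 - inTanh (k n) f ^ 2)) l (𝓝 1) := by
    have := ((hT.pow 2).const_sub 1).sqrt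
    simpa using this
  have hA : ∀ v ∈ f \ I, Tendsto (fun n => contactAngle (k n v) (inTanh (k n) f)) l (𝓝 0) := by
    intro v hv
    obtain ⟨M, hM⟩ := hJ v (Finset.mem_sdiff.1 hv).2
    have h1 : Tendsto (fun n => k n v * inTanh (k n) f) l (𝓝 0) := by
      have h2 := hT.const_mul M
      rw [mul_zero] at h2
      refine tendsto_of_tendsto_of_tendsto_of_le_of_le' tendsto_const_nhds h2
        (Eventually.of_forall fun n => ?_) (hM.mono fun n hn => ?_)
      · exact (mul_pos (h0 n v) (inTanh_pos hf fun v _ => h0 n v)).le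
      · exact mul_le_mul_of_nonneg_right hn (inTanh_pos hf fun v _ => h0 n v).le
    have := (continuous_arctan.tendsto _).comp (h1.div hs one_ne_zero)
    simpa [contactAngle, Function.comp_def] using this
  -- By `sum_contactAngle` this is the boundary term of `mul_arcIntegral` summed over `f ∩ I` and
  -- doubled; the integral terms dropped are nonnegative. Written through the complement `f \ I`, it
  -- visibly tends to `π`.
  refine ⟨fun n => √(1 - inTanh (k n) f ^ 2) *
    (π - 2 * ∑ v ∈ f \ I, contactAngle (k n v) (inTanh (k n) f)), ?_, fun n => ?_⟩
  · have := hs.mul (((tendsto_finsetSum _ hA).const_mul 2).const_sub π)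
    simpa using this
  · have h1 := inTanh_pos hf fun v _ => h0 n v
    have h2 := inTanh_lt_one hf fun v _ => h0 n v
    have h3 := sum_contactAngle hf fun v _ => h0 n v
    rw [← Finset.sum_inter_add_sum_sdiff f I] at h3
    have h4 : π - 2 * ∑ v ∈ f \ I, contactAngle (k n v) (inTanh (k n) f) =
        2 * ∑ v ∈ f ∩ I, contactAngle (k n v) (inTanh (k n) f) := by linarith
    simp only [faceCurvature]
    rw [h4, mul_left_comm, ← Finset.mul_sum, Finset.mul_sum (f ∩ I)]
    exact mul_le_mul_of_nonneg_left (Finset.sum_le_sum fun v _ =>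
      sqrt_mul_contactAngle_le (h0 n v).le h1.le h2) two_pos.le

/-! ### Compactness and existence -/

variable [Fintype V] {L : V → ℝ}

include hF in
/-- Curvatures bounded from below are bounded from above in terms of the total geodesic
curvatures. -/
lemma exists_sum_le_of_vertexCurvature_le
    (hL : ∀ I : Finset V, I.Nonempty →
      ∑ v ∈ I, L v < π * (F.filter (fun f => ∃ v ∈ f, v ∈ I)).card) {ε : ℝ} (hε : 0 < ε) :
    ∃ M, ∀ k : V → ℝ, (∀ v, ε ≤ k v) → (∀ v, vertexCurvature F k v ≤ L v) → ∑ v, k v ≤ M := by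
  by_contra! hcon
  choose k hk hkL hkM using fun n : ℕ => hcon n
  -- Along an ultrafilter each coordinate either tends to infinity or is eventually bounded, so no
  -- subsequences have to be extracted.
  set U := hyperfilter ℕ
  classical
  set I : Finset V := Finset.univ.filter fun v => Tendsto (fun n => k n v) U atTop
  have hI : ∀ v ∈ I, Tendsto (fun n => k n v) U atTop := fun v hv => (Finset.mem_filter.1 hv).2
  have hJ : ∀ v ∉ I, ∃ M, ∀ᶠ n in (U : Filter ℕ), k n v ≤ M := fun v hv => by
    have : ¬ Tendsto (fun n => k n v) U atTop := by simpa [I] using hv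
    rw [tendsto_atTop] at this
    push Not at this
    obtain ⟨M, hM⟩ := this
    exact ⟨M, hM.mono fun n hn => hn.le⟩
  have hne : I.Nonempty := by
    by_contra hempty
    rw [Finset.not_nonempty_iff_eq_empty] at hempty
    choose M hM using fun v => hJ v (by simp [hempty])
    have h1 : ∀ᶠ n in (U : Filter ℕ), ∀ v, k n v ≤ M v := eventually_all.2 hM
    have h2 : ∀ᶠ n : ℕ in (U : Filter ℕ), ∑ v, M v ≤ n := by
      have : Tendsto (fun n : ℕ => (n : ℝ)) U atTop :=
        tendsto_natCast_atTop_atTop.mono_left (Nat.hyperfilter_le_atTop)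
      exact this.eventually_ge_atTop _
    obtain ⟨n, h3, h4⟩ := (h1.and h2).exists
    linarith [hkM n, Finset.sum_le_sum fun v (_ : v ∈ Finset.univ) => h3 v]
  have key := fun f (hf : f ∈ F.filter (fun f => ∃ v ∈ f, v ∈ I)) =>
    exists_tendsto_pi_le_sum_faceCurvature hε hk (hF f (Finset.mem_filter.1 hf).1) hI hJ
      (Finset.mem_filter.1 hf).2
  choose! g hg hgle using key
  have ht := tendsto_finsetSum _ hg
  rw [Finset.sum_const, nsmul_eq_mul, mul_comm] at ht
  refine (hL I hne).not_ge (le_of_tendsto ht (Eventually.of_forall fun n => ?_))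
  calc _ ≤ _ := Finset.sum_le_sum fun f hf => hgle f hf n
    _ = ∑ v ∈ I, vertexCurvature F (k n) v := (sum_vertexCurvature F (k n) I).symm
    _ ≤ _ := Finset.sum_le_sum fun v _ => hkL n v

include hF in
/-- Existence of curvatures with prescribed total geodesic curvatures. -/
theorem exists_vertexCurvature_eq (hpos : ∀ v, 0 < L v)
    (hL : ∀ I : Finset V, I.Nonempty →
      ∑ v ∈ I, L v < π * (F.filter (fun f => ∃ v ∈ f, v ∈ I)).card) :
    ∃ k : V → ℝ, (∀ v, 0 < k v) ∧ ∀ v, vertexCurvature F k v = L v := by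
  obtain ⟨ε, hε, hεL⟩ : ∃ ε : ℝ, 0 < ε ∧ ∀ v, vertexCurvature F (fun _ => ε) v ≤ L v := by
    have h1 : ∀ᶠ ε : ℝ in 𝓝[>] 0, ∀ v, vertexCurvature F (fun _ => ε) v < L v :=
      eventually_all.2 fun v => (tendsto_vertexCurvature_const hF v).eventually_lt_const (hpos v)
    obtain ⟨ε, h2, h3⟩ := (h1.and self_mem_nhdsWithin).exists
    exact ⟨ε, h3, fun v => (h2 v).le⟩
  obtain ⟨M, hM⟩ := exists_sum_le_of_vertexCurvature_le hF hL hε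
  set B : Set (V → ℝ) := {k | ∀ v, ε ≤ k v} with hB
  set A : Set (V → ℝ) := {k | (∀ v, ε ≤ k v) ∧ ∀ v, vertexCurvature F k v ≤ L v} with hA
  have hBclosed : IsClosed B := by
    simp only [hB, ofPred_forall]
    exact isClosed_iInter fun v => isClosed_le continuous_const (continuous_apply v)
  have hBpos : B ⊆ {k | ∀ v, 0 < k v} := fun k hk v => hε.trans_le (hk v)
  have hAclosed : IsClosed A := by
    have : A = B ∩ ⋂ v, B ∩ (fun k => vertexCurvature F k v) ⁻¹' Iic (L v) := by
      ext k
      simp only [hA, mem_ofPred_eq, mem_inter_iff, mem_iInter, mem_preimage, mem_Iic]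
      exact ⟨fun h => ⟨h.1, fun v => ⟨h.1, h.2 v⟩⟩, fun h => ⟨h.1, fun v => (h.2 v).2⟩⟩
    rw [this]
    exact hBclosed.inter (isClosed_iInter fun v =>
      ((continuousOn_vertexCurvature hF v).mono hBpos).preimage_isClosed_of_isClosed hBclosed
        isClosed_Iic)
  have hcomp : IsCompact A := by
    refine (isCompact_Icc (a := fun _ : V => ε) (b := fun _ => M)).of_isClosed_subset hAclosed ?_
    refine fun k hk => ⟨hk.1, fun v => ?_⟩
    refine le_trans ?_ (hM k hk.1 hk.2)
    exact Finset.single_le_sum (fun w _ => hε.le.trans (hk.1 w)) (Finset.mem_univ v)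
  -- At a maximum of `∑ k` on `A` all inequalities are equalities: if there is slack at `v`, raising
  -- `k v` slightly keeps it by continuity, and the curvatures at the other vertices do not
  -- increase. The result is in `A` with a larger sum.
  obtain ⟨k, hkA, hkmax⟩ := hcomp.exists_isMaxOn ⟨fun _ => ε, fun _ => le_rfl, hεL⟩
    (f := fun k => ∑ v, k v) (by fun_prop)
  have hk0 : ∀ v, 0 < k v := fun v => hε.trans_le (hkA.1 v)
  refine ⟨k, hk0, fun v => le_antisymm (hkA.2 v) ?_⟩
  by_contra! hlt
  have hu : Continuous fun δ : ℝ => Function.update k v (k v + δ) :=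
    continuous_const.update v (by fun_prop)
  have h1 : ContinuousAt (fun k => vertexCurvature F k v) k := by
    refine (continuousOn_vertexCurvature hF v).continuousAt (IsOpen.mem_nhds ?_ hk0)
    simp only [ofPred_forall]
    exact isOpen_iInter_of_finite fun v => isOpen_lt continuous_const (continuous_apply v)
  have h2 : Tendsto (fun δ : ℝ => Function.update k v (k v + δ)) (𝓝 0) (𝓝 k) := by
    simpa using hu.tendsto 0
  have h3 := ((h1.tendsto.comp h2).mono_left (nhdsWithin_le_nhds (s := Ioi 0))).eventually_lt_const
    hlt
  obtain ⟨δ, hδ, hδ0 : 0 < δ⟩ := (h3.and self_mem_nhdsWithin).exists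
  have hle : ∀ w, k w ≤ Function.update k v (k v + δ) w := fun w => by
    by_cases h : w = v
    · subst h; simp [hδ0.le]
    · simp [h]
  have hmem : Function.update k v (k v + δ) ∈ A := by
    refine ⟨fun w => (hkA.1 w).trans (hle w), fun w => ?_⟩
    by_cases h : w = v
    · subst h; exact le_of_lt hδ
    · exact (vertexCurvature_anti hF hk0 hle (by simp [h])).trans (hkA.2 w)
  refine (show ∑ w, _ ≤ ∑ w, k w from hkmax hmem).not_gt ?_
  exact Finset.sum_lt_sum (fun w _ => hle w) ⟨v, Finset.mem_univ v, by simpa using hδ0⟩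

end Prescribed

/-! ### Cycles in the upper half-plane -/

/-- The equation `a |z|² + b Re z + c = k Im z` of a circle, horocycle or hypercycle, normalized in
such a way that `k` is its geodesic curvature. -/
structure Cycle (k : ℝ) where
  a : ℝ
  b : ℝ
  c : ℝ
  discrim_eq : b ^ 2 - 4 * a * c = 1 - k ^ 2

/-- The function vanishing on the curve and negative on the disc bounded by a cycle. -/
def Cycle.form {k : ℝ} (N : Cycle k) (z : ℍ) : ℝ :=
  N.a * (z.re ^ 2 + z.im ^ 2) + N.b * z.re + N.c - k * z.im

/-- The generalized disc bounded by a cycle. -/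
def Cycle.disc {k : ℝ} (N : Cycle k) : Set ℍ := {z | N.form z < 0}

lemma Cycle.mem_disc {k : ℝ} {N : Cycle k} {z : ℍ} : z ∈ N.disc ↔ N.form z < 0 := Iff.rfl

lemma div_neg_iff_neg {x y : ℝ} (hy : 0 < y) : x / y < 0 ↔ x < 0 := by
  rw [div_lt_iff₀ hy, zero_mul]

lemma ext_re_im {z w : ℍ} (h1 : z.re = w.re) (h2 : z.im = w.im) : z = w :=
  UpperHalfPlane.ext (Complex.ext h1 h2)

lemma cosh_dist_re_im (z w : ℍ) :
    cosh (dist z w) = 1 + ((z.re - w.re) ^ 2 + (z.im - w.im) ^ 2) / (2 * z.im * w.im) := by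
  rw [UpperHalfPlane.cosh_dist, Complex.dist_eq, Complex.sq_norm, Complex.normSq_apply]
  simp [sq]

lemma sinh_half_dist_sq (z w : ℍ) :
    sinh (dist z w / 2) ^ 2 = ((z.re - w.re) ^ 2 + (z.im - w.im) ^ 2) / (4 * z.im * w.im) := by
  have h := cosh_dist_re_im z w
  have h2 := cosh_two_mul (dist z w / 2)
  rw [mul_div_cancel₀ _ two_ne_zero, cosh_sq] at h2
  have := z.im_pos
  have := w.im_pos
  have e : ((z.re - w.re) ^ 2 + (z.im - w.im) ^ 2) / (4 * z.im * w.im) =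
    ((z.re - w.re) ^ 2 + (z.im - w.im) ^ 2) / (2 * z.im * w.im) / 2 := by field_simp; ring
  rw [e]; linarith

/-- The point of the upper half-plane with the given coordinates. -/
noncomputable def ofReIm (x y : ℝ) : ℍ := UpperHalfPlane.ofComplex ⟨x, y⟩

lemma ofReIm_re {x y : ℝ} (hy : 0 < y) : (ofReIm x y).re = x := by
  rw [ofReIm, UpperHalfPlane.ofComplex_apply_of_im_pos hy]; rfl

lemma ofReIm_im {x y : ℝ} (hy : 0 < y) : (ofReIm x y).im = y := by
  rw [ofReIm, UpperHalfPlane.ofComplex_apply_of_im_pos hy]; rfl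

lemma tendsto_ofReIm (z : ℍ) (u v : ℝ) :
    Tendsto (fun t : ℝ => ofReIm (z.re + t * u) (z.im + t * v)) (𝓝[>] 0) (𝓝 z) := by
  have h : Tendsto UpperHalfPlane.ofComplex (𝓝 (z : ℂ)) (𝓝 z) := by
    have := UpperHalfPlane.ofComplex.continuousAt (x := (z : ℂ))
      (by simpa [UpperHalfPlane.ofComplex] using z.im_pos)
    simpa [ContinuousAt, UpperHalfPlane.ofComplex_apply] using this
  refine h.comp (Tendsto.mono_left ?_ nhdsWithin_le_nhds)
  have hc : Continuous fun t : ℝ => (⟨z.re + t * u, z.im + t * v⟩ : ℂ) := by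
    have : (fun t : ℝ => (⟨z.re + t * u, z.im + t * v⟩ : ℂ)) =
        fun t : ℝ => ((z.re + t * u : ℝ) : ℂ) + ((z.im + t * v : ℝ) : ℂ) * Complex.I :=
      funext fun t => (Complex.mk_eq_add_mul_I _ _)
    rw [this]; fun_prop
  have h0 := hc.tendsto 0
  simp only [zero_mul, add_zero] at h0
  exact h0

lemma im_re_specialLinearGroup_smul (A : SL(2, ℝ)) (z : ℍ) :
    (A • z).im = z.im / ((A 1 0 * z.re + A 1 1) ^ 2 + (A 1 0 * z.im) ^ 2) ∧
    (A • z).re = ((A 0 0 * z.re + A 0 1) * (A 1 0 * z.re + A 1 1) + A 0 0 * A 1 0 * z.im ^ 2) /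
      ((A 1 0 * z.re + A 1 1) ^ 2 + (A 1 0 * z.im) ^ 2) ∧
    0 < (A 1 0 * z.re + A 1 1) ^ 2 + (A 1 0 * z.im) ^ 2 := by
  have hdet := A.det_coe
  rw [Matrix.det_fin_two] at hdet
  have hy := z.im_pos
  have hpos : 0 < (A 1 0 * z.re + A 1 1) ^ 2 + (A 1 0 * z.im) ^ 2 := by
    by_cases h : A 1 0 = 0
    · have : A 1 1 ≠ 0 := fun h' => by simp [h, h'] at hdet
      simp only [h, zero_mul, zero_add]; positivity
    · positivity
  have e := UpperHalfPlane.coe_specialLinearGroup_apply A z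
  have h2 : ((A • z : ℍ) : ℂ).im = (A • z).im := rfl
  have h1 : ((A • z : ℍ) : ℂ).re = (A • z).re := rfl
  have hn : Complex.normSq ((A 1 0 : ℂ) * z + (A 1 1 : ℂ)) =
      (A 1 0 * z.re + A 1 1) ^ 2 + (A 1 0 * z.im) ^ 2 := by
    simp [Complex.normSq_apply]; ring
  refine ⟨?_, ?_, hpos⟩
  · rw [← h2, e]
    simp only [Complex.div_im, Algebra.algebraMap_self, RingHom.id_apply, hn]
    simp
    rw [← sub_div]
    congr 1
    linear_combination z.im * hdet
  · rw [← h1, e]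
    simp only [Complex.div_re, Algebra.algebraMap_self, RingHom.id_apply, hn]
    simp
    field_simp

lemma thickening_halfPlane {r : ℝ} (hr : 0 < r) :
    Metric.thickening r {z : ℍ | z.re ≤ 0} = {z | z.re < sinh r * z.im} := by
  have hs := sinh_pos_iff.2 hr
  ext z
  have hy := z.im_pos
  rw [Metric.mem_thickening_iff]
  constructor
  · rintro ⟨w, hw : w.re ≤ 0, hd⟩
    have hv := w.im_pos
    by_contra! hx
    have hx : sinh r * z.im ≤ z.re := not_lt.1 hx
    have h1 : cosh (dist z w) < cosh r := cosh_lt_cosh.2 (by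
      rwa [abs_of_nonneg dist_nonneg, abs_of_pos hr])
    rw [cosh_dist_re_im] at h1
    have hx0 : 0 < z.re := (mul_pos hs hy).trans_le hx
    have h2 : z.re ^ 2 + z.im ^ 2 + w.im ^ 2 < cosh r * (2 * z.im * w.im) := by
      have h3 : 1 + ((z.re - w.re) ^ 2 + (z.im - w.im) ^ 2) / (2 * z.im * w.im) =
        (z.re ^ 2 + z.im ^ 2 + w.im ^ 2 + (-w.re) * (2 * z.re - w.re)) / (2 * z.im * w.im) := by
        field_simp; ring
      rw [h3, div_lt_iff₀ (by positivity)] at h1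
      nlinarith [mul_nonneg (neg_nonneg.2 hw) (by linarith : 0 ≤ 2 * z.re - w.re)]
    -- Outside the wedge `|z| ≥ cosh r * Im z`, and then `h2` contradicts the inequality between the
    -- arithmetic and geometric means of the squares of `cosh r * z.im` and `w.im`.
    have h4 : (cosh r * z.im) ^ 2 ≤ z.re ^ 2 + z.im ^ 2 := by
      have : (sinh r * z.im) ^ 2 ≤ z.re ^ 2 := pow_le_pow_left₀ (mul_pos hs hy).le hx 2
      rw [mul_pow, cosh_sq]; rw [mul_pow] at this; linarith
    nlinarith [sq_nonneg (cosh r * z.im - w.im)]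
  · intro hx
    have hx : z.re < sinh r * z.im := hx
    rcases le_or_gt z.re 0 with h0 | h0
    · exact ⟨z, h0, by simpa⟩
    · have hq : 0 < √(z.re ^ 2 + z.im ^ 2) := by positivity
      -- The foot of the perpendicular from `z` to the imaginary axis, which runs along a circle
      -- centred at `0`.
      refine ⟨ofReIm 0 (√(z.re ^ 2 + z.im ^ 2)), (ofReIm_re hq).le, ?_⟩
      have : cosh (dist z (ofReIm 0 √(z.re ^ 2 + z.im ^ 2))) < cosh r := by
        rw [cosh_dist_re_im, ofReIm_re hq, ofReIm_im hq]
        have hq2 : √(z.re ^ 2 + z.im ^ 2) ^ 2 = z.re ^ 2 + z.im ^ 2 := sq_sqrt (by positivity)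
        set q := √(z.re ^ 2 + z.im ^ 2)
        have : 1 + ((z.re - 0) ^ 2 + (z.im - q) ^ 2) / (2 * z.im * q) = q / z.im := by
          field_simp; linear_combination -hq2
        rw [this, div_lt_iff₀ hy]
        refine lt_of_pow_lt_pow_left₀ 2 (by positivity) ?_
        rw [hq2, mul_pow, cosh_sq]
        nlinarith
      rwa [cosh_lt_cosh, abs_of_nonneg dist_nonneg, abs_of_pos hr] at this

lemma thickening_smul (A : SL(2, ℝ)) (r : ℝ) (s : Set ℍ) :
    Metric.thickening r (A • s) = A • Metric.thickening r s := by
  ext z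
  rw [Set.mem_smul_set_iff_inv_smul_mem, Metric.mem_thickening_iff, Metric.mem_thickening_iff]
  constructor
  · rintro ⟨w, hw, hd⟩
    refine ⟨A⁻¹ • w, Set.mem_smul_set_iff_inv_smul_mem.1 hw, ?_⟩
    rwa [dist_smul]
  · rintro ⟨w, hw, hd⟩
    refine ⟨A • w, Set.smul_mem_smul_set hw, ?_⟩
    rwa [← dist_smul A⁻¹, inv_smul_smul]

lemma mem_smul_thickening_halfPlane (A : SL(2, ℝ)) {r : ℝ} (hr : 0 < r) (z : ℍ) :
    z ∈ Metric.thickening r (A • {z : ℍ | z.re ≤ 0}) ↔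
      (A⁻¹ 0 0 * z.re + A⁻¹ 0 1) * (A⁻¹ 1 0 * z.re + A⁻¹ 1 1) + A⁻¹ 0 0 * A⁻¹ 1 0 * z.im ^ 2 <
        sinh r * z.im := by
  obtain ⟨h1, h2, h3⟩ := im_re_specialLinearGroup_smul A⁻¹ z
  rw [thickening_smul, thickening_halfPlane hr, Set.mem_smul_set_iff_inv_smul_mem]
  change (A⁻¹ • z).re < sinh r * (A⁻¹ • z).im ↔ _
  rw [h1, h2, ← mul_div_assoc, div_lt_div_iff_of_pos_right h3]

lemma mem_smul_horodisc (A : SL(2, ℝ)) (z : ℍ) :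
    z ∈ A • {z : ℍ | 1 < z.im} ↔
      (A⁻¹ 1 0 * z.re + A⁻¹ 1 1) ^ 2 + (A⁻¹ 1 0 * z.im) ^ 2 < z.im := by
  obtain ⟨h1, h2, h3⟩ := im_re_specialLinearGroup_smul A⁻¹ z
  rw [Set.mem_smul_set_iff_inv_smul_mem]
  change 1 < (A⁻¹ • z).im ↔ _
  rw [h1, lt_div_iff₀ h3, one_mul]

lemma exists_inv_apply_eq {α β γ δ : ℝ} (h : α * δ - β * γ = 1) :
    ∃ A : SL(2, ℝ), A⁻¹ 0 0 = α ∧ A⁻¹ 0 1 = β ∧ A⁻¹ 1 0 = γ ∧ A⁻¹ 1 1 = δ := by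
  obtain ⟨B, hB⟩ : ∃ B : SL(2, ℝ), B.1 = !![α, β; γ, δ] :=
    ⟨⟨!![α, β; γ, δ], by rw [Matrix.det_fin_two_of, h]⟩, rfl⟩
  refine ⟨B⁻¹, ?_⟩
  rw [inv_inv, hB]
  simp

lemma mem_ball_iff {r : ℝ} (hr : 0 < r) (p z : ℍ) :
    z ∈ Metric.ball p r ↔
      z.re ^ 2 + z.im ^ 2 - 2 * z.re * p.re + p.re ^ 2 + p.im ^ 2 <
        2 * (cosh r * p.im) * z.im := by
  have h : z ∈ Metric.ball p r ↔ cosh (dist z p) < cosh r := by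
    rw [Metric.mem_ball, cosh_lt_cosh, abs_of_nonneg dist_nonneg, abs_of_pos hr]
  have := z.im_pos
  have := p.im_pos
  rw [h, cosh_dist_re_im, ← lt_sub_iff_add_lt', div_lt_iff₀ (by positivity)]
  constructor <;> intro h <;> nlinarith

/-- A generalized disc is bounded by a cycle. -/
lemma exists_cycle_disc_eq {k : ℝ} {D : Set ℍ} (hD : IsGeneralizedDisc k D) :
    ∃ N : Cycle k, D = N.disc := by
  rcases hD with ⟨r, hr, rfl, p, rfl⟩ | ⟨rfl, A, rfl⟩ | ⟨r, hr, rfl, H, ⟨A, rfl⟩, rfl⟩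
  · have hs := sinh_pos_iff.2 hr
    have hp := p.im_pos
    refine ⟨⟨1 / (2 * p.im * sinh r), -p.re / (p.im * sinh r),
      (p.re ^ 2 + p.im ^ 2) / (2 * p.im * sinh r), ?_⟩, ?_⟩
    · rw [div_pow, div_pow, cosh_sq]; field_simp; ring
    · ext z
      rw [mem_ball_iff hr]
      rw [Cycle.mem_disc]
      have : Cycle.form (k := cosh r / sinh r) ⟨1 / (2 * p.im * sinh r), -p.re / (p.im * sinh r),
          (p.re ^ 2 + p.im ^ 2) / (2 * p.im * sinh r), by
            rw [div_pow, div_pow, cosh_sq]; field_simp; ring⟩ z =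
          (z.re ^ 2 + z.im ^ 2 - 2 * z.re * p.re + p.re ^ 2 + p.im ^ 2 -
            2 * (cosh r * p.im) * z.im) / (2 * p.im * sinh r) := by
        simp only [Cycle.form]; field_simp; ring
      rw [this, div_neg_iff_neg (by positivity), sub_neg]
  · refine ⟨⟨A⁻¹ 1 0 ^ 2, 2 * A⁻¹ 1 0 * A⁻¹ 1 1, A⁻¹ 1 1 ^ 2, by ring⟩, ?_⟩
    ext z
    rw [mem_smul_horodisc]
    rw [Cycle.mem_disc]
    simp only [Cycle.form]
    constructor <;> intro h <;> nlinarith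
  · have hdet := A⁻¹.det_coe
    rw [Matrix.det_fin_two] at hdet
    have hc := cosh_pos r
    set α := A⁻¹ 0 0
    set β := A⁻¹ 0 1
    set γ := A⁻¹ 1 0
    set δ := A⁻¹ 1 1
    -- The quadratic `(αx + β)(γx + δ)` has discriminant `(αδ - βγ)² = 1`, and `1 / cosh² r = 1 -
    -- tanh² r`.
    have hq : ((α * δ + β * γ) / cosh r) ^ 2 - 4 * (α * γ / cosh r) * (β * δ / cosh r) =
        1 - tanh r ^ 2 := by
      rw [tanh_eq_sinh_div_cosh, div_pow, div_pow, sinh_sq]; field_simp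
      linear_combination (α * δ - β * γ + 1) * hdet
    refine ⟨⟨α * γ / cosh r, (α * δ + β * γ) / cosh r, β * δ / cosh r, hq⟩, ?_⟩
    ext z
    rw [mem_smul_thickening_halfPlane A hr]
    rw [Cycle.mem_disc]
    have : Cycle.form (k := tanh r) ⟨α * γ / cosh r, (α * δ + β * γ) / cosh r, β * δ / cosh r,
        hq⟩ z = ((α * z.re + β) * (γ * z.re + δ) + α * γ * z.im ^ 2 - sinh r * z.im) / cosh r := by
      simp only [Cycle.form, tanh_eq_sinh_div_cosh]; field_simp; ring
    rw [this, div_neg_iff_neg hc, sub_neg]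

lemma Cycle.isGeneralizedDisc {k : ℝ} (hk : 0 < k) (N : Cycle k) (ha : 0 < N.a) :
    IsGeneralizedDisc k N.disc := by
  obtain ⟨a, b, c, hq⟩ := N
  simp only at ha
  rcases lt_trichotomy 1 k with h1 | h1 | h1
  · have hk2 : 0 < k ^ 2 - 1 := by nlinarith
    have hs0 := sqrt_pos.2 hk2
    have hs2 := sq_sqrt hk2.le
    set s := √(k ^ 2 - 1)
    have hsinh : sinh (arsinh (1 / s)) = 1 / s := sinh_arsinh _
    have hcosh : cosh (arsinh (1 / s)) = k / s := by
      rw [cosh_arsinh, div_pow, hs2]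
      rw [show 1 + 1 ^ 2 / (k ^ 2 - 1) = (k / s) ^ 2 by rw [div_pow, hs2]; field_simp; ring]
      exact sqrt_sq (by positivity)
    have hr : 0 < arsinh (1 / s) := arsinh_pos_iff.2 (by positivity)
    refine Or.inl ⟨arsinh (1 / s), hr, by rw [hsinh, hcosh]; field_simp,
      ofReIm (-b / (2 * a)) (s / (2 * a)), ?_⟩
    have hy : 0 < s / (2 * a) := by positivity
    ext z
    rw [mem_ball_iff hr, ofReIm_re hy, ofReIm_im hy, hcosh]
    have : z.re ^ 2 + z.im ^ 2 - 2 * z.re * (-b / (2 * a)) + (-b / (2 * a)) ^ 2 +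
        (s / (2 * a)) ^ 2 - 2 * (k / s * (s / (2 * a))) * z.im =
        Cycle.form ⟨a, b, c, hq⟩ z / a := by
      simp only [Cycle.form, div_pow, hs2]; field_simp; linear_combination hq
    rw [Iff.comm, ← sub_neg, this, div_neg_iff_neg ha]
    rfl
  · subst h1
    refine Or.inr (Or.inl ⟨rfl, ?_⟩)
    have hs0 := sqrt_pos.2 ha
    have hs2 := sq_sqrt ha.le
    set s := √a
    obtain ⟨A, -, -, h10, h11⟩ := exists_inv_apply_eq
      (show 0 * (b / (2 * s)) - (-1 / s) * s = 1 by field_simp; ring)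
    refine ⟨A, ?_⟩
    ext z
    rw [mem_smul_horodisc, h10, h11, Iff.comm, ← sub_neg]
    have : (s * z.re + b / (2 * s)) ^ 2 + (s * z.im) ^ 2 - z.im = Cycle.form ⟨a, b, c, hq⟩ z := by
      have h2 : (s * z.re + b / (2 * s)) ^ 2 =
          s ^ 2 * z.re ^ 2 + b * z.re + b ^ 2 / (4 * s ^ 2) := by field_simp; ring
      rw [h2, mul_pow, hs2]
      simp only [Cycle.form]; field_simp; linear_combination hq
    rw [this]; rfl
  · refine Or.inr (Or.inr ?_)
    have hk2 : 0 < 1 - k ^ 2 := by nlinarith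
    have hs0 := sqrt_pos.2 hk2
    have hs2 := sq_sqrt hk2.le
    set s := √(1 - k ^ 2)
    have hsinh : sinh (arsinh (k / s)) = k / s := sinh_arsinh _
    have hcosh : cosh (arsinh (k / s)) = 1 / s := by
      rw [cosh_arsinh, div_pow, hs2]
      rw [show 1 + k ^ 2 / (1 - k ^ 2) = (1 / s) ^ 2 by rw [div_pow, hs2]; field_simp; ring]
      exact sqrt_sq (by positivity)
    have hr : 0 < arsinh (k / s) := arsinh_pos_iff.2 (by positivity)
    -- The rows are the linear factors of `(a x² + b x + c) / s`, whose roots are the ideal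
    -- endpoints of the axis; `A⁻¹` takes these to `0` and `∞`.
    obtain ⟨A, h00, h01, h10, h11⟩ := exists_inv_apply_eq
      (show a / s * ((b / s + 1) / (2 * (a / s))) - (b / s - 1) / 2 * 1 = 1 by field_simp; ring)
    refine ⟨arsinh (k / s), hr, by rw [tanh_eq_sinh_div_cosh, hsinh, hcosh]; field_simp, _,
      ⟨A, rfl⟩, ?_⟩
    ext z
    rw [mem_smul_thickening_halfPlane _ hr, h00, h01, h10, h11, hsinh, Iff.comm, ← sub_neg]
    have : (a / s * z.re + (b / s - 1) / 2) * (1 * z.re + (b / s + 1) / (2 * (a / s))) +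
        a / s * 1 * z.im ^ 2 - k / s * z.im = Cycle.form ⟨a, b, c, hq⟩ z / s := by
      simp only [Cycle.form]; field_simp; linear_combination hq - hs2
    rw [this, div_neg_iff_neg hs0]; rfl

/-! ### Tangent cycles -/

section Tangent

variable {k k' : ℝ}

lemma Cycle.continuous_form (N : Cycle k) : Continuous N.form := by
  have := UpperHalfPlane.continuous_re
  have := UpperHalfPlane.continuous_im
  unfold Cycle.form
  fun_prop

lemma Cycle.gradient_sq (N : Cycle k) {z : ℍ} (hz : N.form z = 0) :
    (2 * N.a * z.re + N.b) ^ 2 + (2 * N.a * z.im - k) ^ 2 = 1 := by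
  have := N.discrim_eq
  simp only [Cycle.form] at hz
  linear_combination 4 * N.a * hz + this

lemma Cycle.form_ofReIm (N : Cycle k) (z : ℍ) (u v : ℝ) {t : ℝ} (h : 0 < z.im + t * v) :
    N.form (ofReIm (z.re + t * u) (z.im + t * v)) = N.form z +
      t * ((2 * N.a * z.re + N.b) * u + (2 * N.a * z.im - k) * v + t * N.a * (u ^ 2 + v ^ 2)) := by
  simp only [Cycle.form, ofReIm_re h, ofReIm_im h]
  ring

/-- A point on a cycle can be moved into the disc in any direction pointing inwards. -/
lemma Cycle.eventually_form_neg (N : Cycle k) {z : ℍ} (hz : N.form z = 0) {u v : ℝ}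
    (h : (2 * N.a * z.re + N.b) * u + (2 * N.a * z.im - k) * v < 0) :
    ∀ᶠ t in 𝓝[>] (0 : ℝ), N.form (ofReIm (z.re + t * u) (z.im + t * v)) < 0 := by
  have h1 : ∀ᶠ t in 𝓝[>] (0 : ℝ), 0 < z.im + t * v := by
    have : Tendsto (fun t : ℝ => z.im + t * v) (𝓝 0) (𝓝 (z.im + 0 * v)) :=
      Continuous.tendsto (by fun_prop) 0
    exact (this.mono_left nhdsWithin_le_nhds).eventually_const_lt (by simpa using z.im_pos)
  have h2 : ∀ᶠ t in 𝓝[>] (0 : ℝ), (2 * N.a * z.re + N.b) * u + (2 * N.a * z.im - k) * v +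
      t * N.a * (u ^ 2 + v ^ 2) < 0 := by
    have : Tendsto (fun t : ℝ => (2 * N.a * z.re + N.b) * u + (2 * N.a * z.im - k) * v +
        t * N.a * (u ^ 2 + v ^ 2)) (𝓝 0) (𝓝 ((2 * N.a * z.re + N.b) * u +
        (2 * N.a * z.im - k) * v + 0 * N.a * (u ^ 2 + v ^ 2))) :=
      Continuous.tendsto (by fun_prop) 0
    exact (this.mono_left nhdsWithin_le_nhds).eventually_lt_const (by simpa using h)
  filter_upwards [h1, h2, self_mem_nhdsWithin] with t h3 h4 h5
  rw [N.form_ofReIm z u v h3, hz, zero_add]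
  exact mul_neg_of_pos_of_neg h5 h4

/-- A zero of the form is a limit of points of the disc because the gradient there has length one:
move against it. -/
lemma Cycle.frontier_disc (N : Cycle k) : frontier N.disc = {z | N.form z = 0} := by
  refine Subset.antisymm (frontier_lt_subset_eq N.continuous_form continuous_const) fun z hz => ?_
  have hz : N.form z = 0 := hz
  have ho : IsOpen N.disc := isOpen_lt N.continuous_form continuous_const
  rw [ho.frontier_eq]
  refine ⟨?_, fun h => (show N.form z < 0 from h).ne hz⟩
  refine mem_closure_of_tendsto (tendsto_ofReIm z (-(2 * N.a * z.re + N.b))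
    (-(2 * N.a * z.im - k))) (N.eventually_form_neg hz ?_)
  linarith [N.gradient_sq hz]

/-- Two cycles touch each other from outside at `p`. -/
structure Cycle.TouchAt (N : Cycle k) (N' : Cycle k') (p : ℍ) : Prop where
  im_eq : 2 * (N.a + N'.a) * p.im = k + k'
  re_eq : 2 * (N.a + N'.a) * p.re = -(N.b + N'.b)
  sq_eq : (N.a + N'.a) * (p.re ^ 2 + p.im ^ 2) = N.c + N'.c

lemma Cycle.TouchAt.form_add {N : Cycle k} {N' : Cycle k'} {p : ℍ} (h : N.TouchAt N' p) (z : ℍ) :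
    N.form z + N'.form z = (N.a + N'.a) * ((z.re - p.re) ^ 2 + (z.im - p.im) ^ 2) := by
  simp only [Cycle.form]
  linear_combination z.im * h.im_eq + z.re * h.re_eq - h.sq_eq

lemma Cycle.TouchAt.add_pos {N : Cycle k} {N' : Cycle k'} {p : ℍ} (h : N.TouchAt N' p)
    (hk : 0 < k) (hk' : 0 < k') : 0 < N.a + N'.a := by
  have := h.im_eq
  have := p.im_pos
  by_contra! hc
  nlinarith

lemma Cycle.TouchAt.eq_of_form_eq_zero {N : Cycle k} {N' : Cycle k'} {p : ℍ}
    (h : N.TouchAt N' p) (hk : 0 < k) (hk' : 0 < k') {z : ℍ} (hz : N.form z = 0)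
    (hz' : N'.form z = 0) : z = p := by
  have h1 := h.form_add z
  rw [hz, hz', add_zero, eq_comm, mul_eq_zero] at h1
  have h2 := h1.resolve_left (h.add_pos hk hk').ne'
  refine ext_re_im ?_ ?_ <;> nlinarith [sq_nonneg (z.re - p.re), sq_nonneg (z.im - p.im)]

/-- The sum of the two cycles is isotropic for `b² - 4ac + k²`, for which each cycle has norm one,
so their mixed product is `-1`. -/
lemma Cycle.TouchAt.gram {N : Cycle k} {N' : Cycle k'} {p : ℍ} (h : N.TouchAt N' p) :
    N.b * N'.b - 2 * N.a * N'.c - 2 * N'.a * N.c = -1 - k * k' := by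
  have h1 := N.discrim_eq
  have h2 := N'.discrim_eq
  have h3 : (N.b + N'.b) ^ 2 = (2 * (N.a + N'.a) * p.re) ^ 2 := by rw [h.re_eq]; ring
  have h4 : (k + k') ^ 2 = (2 * (N.a + N'.a) * p.im) ^ 2 := by rw [h.im_eq]
  linear_combination (1 / 2) * h3 + (1 / 2) * h4 - (1 / 2) * h1 - (1 / 2) * h2 +
    2 * (N.a + N'.a) * h.sq_eq

lemma exists_touchAt_of_externallyTangent {N : Cycle k} {N' : Cycle k'}
    (h : ExternallyTangent N.disc N'.disc) :
    ∃ p, N.TouchAt N' p ∧ N.form p = 0 ∧ N'.form p = 0 := by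
  obtain ⟨hd, p, hp, hp'⟩ := h
  rw [Cycle.frontier_disc] at hp hp'
  have hp : N.form p = 0 := hp
  have hp' : N'.form p = 0 := hp'
  have g := N.gradient_sq hp
  have g' := N'.gradient_sq hp'
  set g1 := 2 * N.a * p.re + N.b with hg1
  set g2 := 2 * N.a * p.im - k with hg2
  set g1' := 2 * N'.a * p.re + N'.b with hg1'
  set g2' := 2 * N'.a * p.im - k' with hg2'
  -- The gradients are unit vectors. Unless they are opposite, the direction `-(g + g')` points into
  -- both discs, which are disjoint.
  have key : 1 + (g1 * g1' + g2 * g2') ≤ 0 := by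
    by_contra! hpos
    have e1 := N.eventually_form_neg hp (u := -(g1 + g1')) (v := -(g2 + g2')) (by nlinarith)
    have e2 := N'.eventually_form_neg hp' (u := -(g1 + g1')) (v := -(g2 + g2')) (by nlinarith)
    obtain ⟨t, h1, h2⟩ := (e1.and e2).exists
    exact Set.disjoint_left.1 hd h1 h2
  have s1 : g1 + g1' = 0 := by nlinarith [sq_nonneg (g1 + g1'), sq_nonneg (g2 + g2')]
  have s2 : g2 + g2' = 0 := by nlinarith [sq_nonneg (g1 + g1'), sq_nonneg (g2 + g2')]
  refine ⟨p, ⟨by linarith, by linarith, ?_⟩, hp, hp'⟩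
  simp only [Cycle.form] at hp hp'
  simp only [hg1, hg2, hg1', hg2'] at s1 s2
  linear_combination p.re * s1 + p.im * s2 - hp - hp'

lemma externallyTangent_of_gram {N : Cycle k} {N' : Cycle k'} (hk : 0 < k) (hk' : 0 < k')
    (ha : 0 < N.a) (ha' : 0 < N'.a)
    (h : N.b * N'.b - 2 * N.a * N'.c - 2 * N'.a * N.c = -1 - k * k') :
    ExternallyTangent N.disc N'.disc := by
  have h1 := N.discrim_eq
  have h2 := N'.discrim_eq
  have hy : 0 < (k + k') / (2 * (N.a + N'.a)) := by positivity
  set p : ℍ := ofReIm (-(N.b + N'.b) / (2 * (N.a + N'.a))) ((k + k') / (2 * (N.a + N'.a)))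
    with hp
  have hpre : p.re = -(N.b + N'.b) / (2 * (N.a + N'.a)) := ofReIm_re hy
  have hpim : p.im = (k + k') / (2 * (N.a + N'.a)) := ofReIm_im hy
  have ht : N.TouchAt N' p := by
    refine ⟨by rw [hpim]; field_simp, by rw [hpre]; field_simp, ?_⟩
    rw [hpim, hpre]; field_simp; linear_combination h1 + h2 + 2 * h
  have hf : N.form p = 0 := by
    simp only [Cycle.form]
    have e : N.a * (p.re ^ 2 + p.im ^ 2) = N.a * (N.c + N'.c) / (N.a + N'.a) := by
      rw [← ht.sq_eq]; field_simp
    rw [e, hpre, hpim]; field_simp; linear_combination -h1 - h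
  have hf' : N'.form p = 0 := by
    have := ht.form_add p
    rw [hf] at this; simpa using this
  refine ⟨Set.disjoint_left.2 fun z hz hz' => ?_, p, ?_, ?_⟩
  · have e := ht.form_add z
    rw [Cycle.mem_disc] at hz hz'
    have : 0 ≤ (N.a + N'.a) * ((z.re - p.re) ^ 2 + (z.im - p.im) ^ 2) := by positivity
    linarith
  · rw [Cycle.frontier_disc]; exact hf
  · rw [Cycle.frontier_disc]; exact hf'

/-- The distance of the two points in which a cycle touches two other cycles tangent to each
other. -/
lemma sinh_half_dist_touchAt {k₁ k₂ k₃ : ℝ} {N₁ : Cycle k₁} {N₂ : Cycle k₂} {N₃ : Cycle k₃}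
    (h₁ : 0 < k₁) (h₂ : 0 < k₂) (h₃ : 0 < k₃) {p q r : ℍ} (hp : N₁.TouchAt N₂ p)
    (hq : N₁.TouchAt N₃ q) (hr : N₂.TouchAt N₃ r) :
    sinh (dist p q / 2) ^ 2 = 1 / ((k₁ + k₂) * (k₁ + k₃)) := by
  rw [sinh_half_dist_sq]
  have a1 := hp.add_pos h₁ h₂
  have a2 := hq.add_pos h₁ h₃
  have d1 := N₁.discrim_eq
  have g1 := hp.gram
  have g2 := hq.gram
  have g3 := hr.gram
  have yp := p.im_pos
  have yq := q.im_pos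
  -- The isotropic vectors of `p` and `q` have Lorentz product `-2 (N₁.a + N₂.a)(N₁.a + N₃.a) |p -
  -- q|²`. Expanded through the cycles it is `1 - 1 - 1 - 1 = -2`.
  have key : ((p.re - q.re) ^ 2 + (p.im - q.im) ^ 2) * ((N₁.a + N₂.a) * (N₁.a + N₃.a)) = 1 := by
    have e1 : (N₁.a + N₂.a) * p.re * ((N₁.a + N₃.a) * q.re) =
        (N₁.b + N₂.b) * (N₁.b + N₃.b) / 4 := by
      linear_combination ((N₁.a + N₃.a) * q.re / 2) * hp.re_eq - (N₁.b + N₂.b) / 4 * hq.re_eq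
    have e2 : (N₁.a + N₂.a) * p.im * ((N₁.a + N₃.a) * q.im) = (k₁ + k₂) * (k₁ + k₃) / 4 := by
      linear_combination ((N₁.a + N₃.a) * q.im / 2) * hp.im_eq + (k₁ + k₂) / 4 * hq.im_eq
    linear_combination (N₁.a + N₃.a) * hp.sq_eq + (N₁.a + N₂.a) * hq.sq_eq - 2 * e1 - 2 * e2 -
      (1 / 2) * (d1 + g1 + g2 + g3)
  rw [← hp.im_eq, ← hq.im_eq, div_eq_div_iff (by positivity) (by positivity)]
  linear_combination 4 * p.im * q.im * key

/-- Three mutually tangent cycles of given curvatures. -/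
lemma exists_three_cycles {k₁ k₂ k₃ : ℝ} (h₁ : 0 < k₁) (h₂ : 0 < k₂) (h₃ : 0 < k₃) :
    ∃ (D₁ D₂ D₃ : Set ℍ), IsGeneralizedDisc k₁ D₁ ∧ IsGeneralizedDisc k₂ D₂ ∧
      IsGeneralizedDisc k₃ D₃ ∧ ExternallyTangent D₁ D₂ ∧ ExternallyTangent D₁ D₃ ∧
      ExternallyTangent D₂ D₃ := by
  have hσ : 0 < 1 + (k₁ * k₂ + k₁ * k₃ + k₂ * k₃) := by positivity
  have hs := sq_sqrt hσ.le
  have hs0 := sqrt_pos.2 hσ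
  set s := √(1 + (k₁ * k₂ + k₁ * k₃ + k₂ * k₃))
  -- The first two cycles touch the imaginary axis at `i` from opposite sides. For the third, the
  -- two tangency equations determine `b` and `a + c`, and the discriminant then gives `a - c = ±2s
  -- / (k₁ + k₂)`; the plus sign makes `a` positive.
  let N₁ : Cycle k₁ := ⟨k₁ / 2, 1, k₁ / 2, by ring⟩
  let N₂ : Cycle k₂ := ⟨k₂ / 2, -1, k₂ / 2, by ring⟩
  let N₃ : Cycle k₃ := ⟨k₃ / 2 + (1 + s) / (k₁ + k₂), (k₁ - k₂) / (k₁ + k₂),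
    k₃ / 2 + (1 - s) / (k₁ + k₂), by field_simp; linear_combination 16 * hs⟩
  have a₁ : 0 < N₁.a := half_pos h₁
  have a₂ : 0 < N₂.a := half_pos h₂
  have a₃ : 0 < N₃.a := by simp only [N₃]; positivity
  refine ⟨N₁.disc, N₂.disc, N₃.disc, N₁.isGeneralizedDisc h₁ a₁, N₂.isGeneralizedDisc h₂ a₂,
    N₃.isGeneralizedDisc h₃ a₃, externallyTangent_of_gram h₁ h₂ a₁ a₂ ?_,
    externallyTangent_of_gram h₁ h₃ a₁ a₃ ?_, externallyTangent_of_gram h₂ h₃ a₂ a₃ ?_⟩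
  · simp only [N₁, N₂]; ring
  · simp only [N₁, N₃]; field_simp; ring
  · simp only [N₂, N₃]; field_simp; ring

end Tangent

/-! ### Comparison of path lengths -/

/-- If `f` moves at small scale hardly faster than `g`, it moves no farther than `g` in total: cut
`[a, b]` into equal short steps, add up, and let `ε` tend to zero. No derivative of either map is
needed. -/
lemma edist_le_eVariationOn_of_forall {E E' : Type*} [PseudoEMetricSpace E]
    [PseudoEMetricSpace E'] {f : ℝ → E} {g : ℝ → E'} {a b : ℝ} (hab : a ≤ b)
    (h : ∀ ε : ℝ, 0 < ε → ∃ δ > 0, ∀ s ∈ Icc a b, ∀ t ∈ Icc a b, |s - t| < δ →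
      edist (f s) (f t) ≤ ENNReal.ofReal (1 + ε) * edist (g s) (g t)) :
    edist (f a) (f b) ≤ eVariationOn g (Icc a b) := by
  have key : ∀ ε : ℝ, 0 < ε →
      edist (f a) (f b) ≤ ENNReal.ofReal (1 + ε) * eVariationOn g (Icc a b) := by
    intro ε hε
    obtain ⟨δ, hδ, H⟩ := h ε hε
    obtain ⟨n, hn⟩ := exists_nat_gt ((b - a) / δ)
    have hn1 : (0 : ℝ) < n + 1 := by positivity
    -- The minimum makes the subdivision a monotone sequence on all of `ℕ`, constant after index `n
    -- + 1`.
    set u : ℕ → ℝ := fun i => a + min (i / (n + 1) : ℝ) 1 * (b - a) with hu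
    have hba : 0 ≤ b - a := sub_nonneg.2 hab
    have um : Monotone u := fun i j hij => by
      simp only [hu]; gcongr
    have umem : ∀ i, u i ∈ Icc a b := fun i => by
      have h1 : min (i / (n + 1) : ℝ) 1 ≤ 1 := min_le_right _ _
      have h0 : 0 ≤ min (i / (n + 1) : ℝ) 1 := le_min (by positivity) zero_le_one
      constructor <;> simp only [hu] <;> nlinarith
    have u0 : u 0 = a := by simp [hu]
    have u1 : u (n + 1) = b := by
      simp only [hu]; push_cast; rw [div_self hn1.ne']; simp
    have step : ∀ i ∈ Finset.range (n + 1), |u (i + 1) - u i| < δ := fun i hi => by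
      have hi' : (i : ℝ) + 1 ≤ n + 1 := by exact_mod_cast Finset.mem_range.1 hi
      have e1 : min ((i + 1 : ℕ) / (n + 1) : ℝ) 1 = (i + 1) / (n + 1) := by
        push_cast; exact min_eq_left ((div_le_one hn1).2 hi')
      have e2 : min (i / (n + 1) : ℝ) 1 = i / (n + 1) :=
        min_eq_left ((div_le_one hn1).2 (by linarith))
      have e : u (i + 1) - u i = (b - a) / (n + 1) := by
        simp only [hu, e1, e2]; field_simp; ring
      rw [e, abs_of_nonneg (by positivity), div_lt_iff₀ hn1]
      rw [div_lt_iff₀ hδ] at hn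
      nlinarith
    calc edist (f a) (f b) = edist (f (u 0)) (f (u (n + 1))) := by rw [u0, u1]
      _ ≤ ∑ i ∈ Finset.range (n + 1), edist (f (u i)) (f (u (i + 1))) :=
        edist_le_range_sum_edist (fun i => f (u i)) (n + 1)
      _ ≤ ∑ i ∈ Finset.range (n + 1),
          ENNReal.ofReal (1 + ε) * edist (g (u (i + 1))) (g (u i)) := by
        refine Finset.sum_le_sum fun i hi => ?_
        rw [edist_comm]
        exact H _ (umem _) _ (umem _) (step i hi)
      _ = ENNReal.ofReal (1 + ε) * ∑ i ∈ Finset.range (n + 1), edist (g (u (i + 1))) (g (u i)) :=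
        (Finset.mul_sum _ _ _).symm
      _ ≤ _ := mul_le_mul_right (eVariationOn.sum_le um umem) _
  have ht : Tendsto (fun ε : ℝ => ENNReal.ofReal (1 + ε) * eVariationOn g (Icc a b)) (𝓝[>] 0)
      (𝓝 (ENNReal.ofReal (1 + 0) * eVariationOn g (Icc a b))) := by
    refine ENNReal.Tendsto.mul_const ?_ (Or.inl (by simp))
    refine (ENNReal.tendsto_ofReal ?_).mono_left nhdsWithin_le_nhds
    exact Continuous.tendsto (by fun_prop) 0
  simp only [add_zero, ENNReal.ofReal_one, one_mul] at ht
  exact ge_of_tendsto ht (eventually_mem_nhdsWithin.mono fun ε hε => key ε hε)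

/-! ### The arc length parameter -/

section ArcIntegral

variable {k T : ℝ}

lemma one_add_mul_sq_pos_of_abs_le (hT : 0 < 1 + (k ^ 2 - 1) * T ^ 2) {x : ℝ}
    (hx : x ∈ Icc (-T) T) :
    0 < 1 + (k ^ 2 - 1) * x ^ 2 := by
  have : x ^ 2 ≤ T ^ 2 := sq_le_sq.2 ((abs_le.2 hx).trans (le_abs_self T))
  rcases le_total 1 (k ^ 2) with h | h <;> nlinarith [sq_nonneg x]

lemma hasDerivAt_arcIntegral (hT : 0 < 1 + (k ^ 2 - 1) * T ^ 2) {x : ℝ}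
    (hx : x ∈ Icc (-T) T) :
    HasDerivAt (arcIntegral k) (1 / (1 + (k ^ 2 - 1) * x ^ 2)) x := by
  have hT0 : 0 ≤ T := by linarith [hx.1, hx.2]
  have hc : ContinuousOn (fun x : ℝ => 1 / (1 + (k ^ 2 - 1) * x ^ 2))
      {x | 0 < 1 + (k ^ 2 - 1) * x ^ 2} :=
    ContinuousOn.div (by fun_prop) (by fun_prop) fun x hx => (ne_of_gt hx)
  have ho : IsOpen {x : ℝ | 0 < 1 + (k ^ 2 - 1) * x ^ 2} :=
    isOpen_lt continuous_const (by fun_prop)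
  have hxm : x ∈ {x : ℝ | 0 < 1 + (k ^ 2 - 1) * x ^ 2} := one_add_mul_sq_pos_of_abs_le hT hx
  refine intervalIntegral.integral_hasDerivAt_right ?_ ?_ (hc.continuousAt (ho.mem_nhds hxm))
  · refine (hc.mono fun y hy => one_add_mul_sq_pos_of_abs_le hT ?_).intervalIntegrable
    exact uIcc_subset_Icc ⟨by linarith, hT0⟩ hx hy
  · exact hc.stronglyMeasurableAtFilter ho x hxm

lemma continuousOn_arcIntegral (hT : 0 < 1 + (k ^ 2 - 1) * T ^ 2) :
    ContinuousOn (arcIntegral k) (Icc (-T) T) := fun _ hx =>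
  (hasDerivAt_arcIntegral hT hx).continuousAt.continuousWithinAt

lemma arcIntegral_neg (k x : ℝ) : arcIntegral k (-x) = -arcIntegral k x := by
  have h := intervalIntegral.integral_comp_neg (a := 0) (b := x)
    fun x : ℝ => 1 / (1 + (k ^ 2 - 1) * x ^ 2)
  simp only [even_two, Even.neg_pow, neg_zero] at h
  rw [arcIntegral, arcIntegral, h, intervalIntegral.integral_symm]

lemma arcIntegral_zero (k : ℝ) : arcIntegral k 0 = 0 := intervalIntegral.integral_same

lemma monotoneOn_arcIntegral (hT : 0 < 1 + (k ^ 2 - 1) * T ^ 2) :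
    MonotoneOn (arcIntegral k) (Icc (-T) T) := by
  refine monotoneOn_of_deriv_nonneg (convex_Icc _ _) (continuousOn_arcIntegral hT) ?_ ?_
  · exact fun x hx => (hasDerivAt_arcIntegral hT (interior_subset hx)).differentiableAt
      |>.differentiableWithinAt
  · intro x hx
    rw [(hasDerivAt_arcIntegral hT (interior_subset hx)).deriv]
    exact (one_div_pos.2 (one_add_mul_sq_pos_of_abs_le hT (interior_subset hx))).le

lemma exists_abs_arcIntegral_sub_eq (hT : 0 < 1 + (k ^ 2 - 1) * T ^ 2) {x y : ℝ}
    (hx : x ∈ Icc (-T) T) (hy : y ∈ Icc (-T) T) :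
    ∃ ξ ∈ Icc (-T) T, |x - ξ| ≤ |x - y| ∧ |y - ξ| ≤ |x - y| ∧
      |arcIntegral k x - arcIntegral k y| = |x - y| / (1 + (k ^ 2 - 1) * ξ ^ 2) := by
  have key : ∀ x ∈ Icc (-T) T, ∀ y ∈ Icc (-T) T, x < y →
      ∃ ξ ∈ Icc (-T) T, |x - ξ| ≤ |x - y| ∧ |y - ξ| ≤ |x - y| ∧
        |arcIntegral k x - arcIntegral k y| = |x - y| / (1 + (k ^ 2 - 1) * ξ ^ 2) := by
    intro x hx y hy hxy
    obtain ⟨ξ, hξ, e⟩ := exists_hasDerivAt_eq_slope (arcIntegral k)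
      (fun x => 1 / (1 + (k ^ 2 - 1) * x ^ 2)) hxy
      ((continuousOn_arcIntegral hT).mono (Icc_subset_Icc hx.1 hy.2))
      fun z hz => hasDerivAt_arcIntegral hT ⟨hx.1.trans hz.1.le, hz.2.le.trans hy.2⟩
    have hξT : ξ ∈ Icc (-T) T := ⟨hx.1.trans hξ.1.le, hξ.2.le.trans hy.2⟩
    have hp := one_add_mul_sq_pos_of_abs_le hT hξT
    have e1 : |x - y| = y - x := by rw [abs_sub_comm, abs_of_pos (sub_pos.2 hxy)]
    refine ⟨ξ, hξT, ?_, ?_, ?_⟩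
    · rw [e1, abs_sub_comm, abs_of_pos (sub_pos.2 hξ.1)]; linarith [hξ.2]
    · rw [e1, abs_of_pos (sub_pos.2 hξ.2)]; linarith [hξ.1]
    · have hyx := sub_pos.2 hxy
      have e2 : arcIntegral k y - arcIntegral k x = (y - x) / (1 + (k ^ 2 - 1) * ξ ^ 2) := by
        rw [eq_div_iff hyx.ne'] at e
        rw [← e]; ring
      rw [e1, abs_sub_comm, e2, abs_of_pos (by positivity)]
  rcases lt_trichotomy x y with h | h | h
  · exact key x hx y hy h
  · subst h; exact ⟨x, hx, by simp⟩
  · obtain ⟨ξ, h1, h2, h3, h4⟩ := key y hy x hx h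
    refine ⟨ξ, h1, ?_, ?_, ?_⟩
    · rwa [abs_sub_comm x y]
    · rwa [abs_sub_comm x y]
    · rwa [abs_sub_comm x y, abs_sub_comm (arcIntegral k x)]

lemma sinh_le_cosh_mul_self {x : ℝ} (hx : 0 ≤ x) : sinh x ≤ cosh x * x := by
  rcases hx.eq_or_lt with rfl | hx
  · simp
  obtain ⟨ξ, hξ, e⟩ := exists_hasDerivAt_eq_slope sinh cosh hx continuous_sinh.continuousOn
    fun z _ => hasDerivAt_sinh z
  rw [sinh_zero, sub_zero, sub_zero, eq_div_iff hx.ne'] at e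
  rw [← e]
  refine mul_le_mul_of_nonneg_right (cosh_le_cosh.2 ?_) hx.le
  rw [abs_of_pos hξ.1, abs_of_pos hx]
  exact hξ.2.le

/-- Short chords and arcs are comparable. -/
lemma exists_chord_arc_comparison (hT0 : 0 ≤ T) (hT : 0 < 1 + (k ^ 2 - 1) * T ^ 2) {ε : ℝ}
    (hε : 0 < ε) :
    ∃ δ > 0, ∀ x ∈ Icc (-T) T, ∀ y ∈ Icc (-T) T, ∀ d : ℝ, 0 ≤ d →
      sinh (d / 2) ^ 2 =
        (x - y) ^ 2 / ((1 + (k ^ 2 - 1) * x ^ 2) * (1 + (k ^ 2 - 1) * y ^ 2)) →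
      (|x - y| < δ → d ≤ (1 + ε) * |2 * arcIntegral k x - 2 * arcIntegral k y|) ∧
      (d < δ → |2 * arcIntegral k x - 2 * arcIntegral k y| ≤ (1 + ε) * d) := by
  set κ := k ^ 2 - 1 with hκ
  -- A factor `1 + η` is lost up to twice, and `(1 + η)² ≤ 1 + 3η ≤ 1 + ε`.
  set η := min 1 (ε / 3) with hη
  have η0 : 0 < η := lt_min one_pos (by positivity)
  have η1 : η ≤ 1 := min_le_left _ _
  have ηε : 3 * η ≤ ε := by linarith [min_le_right 1 (ε / 3)]
  set m := min 1 (1 + κ * T ^ 2) with hm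
  have m0 : 0 < m := lt_min one_pos hT
  have hsq : ∀ x ∈ Icc (-T) T, x ^ 2 ≤ T ^ 2 := fun x hx =>
    sq_le_sq.2 ((abs_le.2 hx).trans (le_abs_self T))
  have hmle : ∀ x ∈ Icc (-T) T, m ≤ 1 + κ * x ^ 2 := fun x hx => by
    have := hsq x hx
    rcases le_total 0 κ with h | h
    · exact (min_le_left _ _).trans (le_add_of_nonneg_right (mul_nonneg h (sq_nonneg x)))
    · exact (min_le_right _ _).trans
        (add_le_add_right (mul_le_mul_of_nonpos_left this h) 1)
  set M := 1 + |κ| * T ^ 2 with hM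
  have M0 : 0 < M := by positivity
  have hMle : ∀ x ∈ Icc (-T) T, 1 + κ * x ^ 2 ≤ M := fun x hx => by
    have := hsq x hx
    have h1 : κ * x ^ 2 ≤ |κ| * x ^ 2 := mul_le_mul_of_nonneg_right (le_abs_self κ) (sq_nonneg x)
    have h2 : |κ| * x ^ 2 ≤ |κ| * T ^ 2 := mul_le_mul_of_nonneg_left this (abs_nonneg κ)
    linarith
  obtain ⟨δ₁, δ₁0, hδ₁⟩ : ∃ δ₁ > 0, 2 * |κ| * T * δ₁ ≤ η * m := by
    refine ⟨η * m / (2 * |κ| * T + 1), by positivity, ?_⟩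
    rw [← mul_div_assoc, div_le_iff₀ (by positivity)]
    linarith [mul_pos η0 m0]
  have hcmp : ∀ x ∈ Icc (-T) T, ∀ y ∈ Icc (-T) T, |x - y| < δ₁ →
      1 + κ * x ^ 2 ≤ (1 + η) * (1 + κ * y ^ 2) := fun x hx y hy hxy => by
    have h1 : |κ * (x ^ 2 - y ^ 2)| ≤ 2 * |κ| * T * δ₁ := by
      have : κ * (x ^ 2 - y ^ 2) = κ * ((x + y) * (x - y)) := by ring
      rw [this, abs_mul, abs_mul]
      have h2 : |x + y| ≤ 2 * T := by rw [abs_le]; constructor <;> linarith [hx.1, hx.2, hy.1, hy.2]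
      calc |κ| * (|x + y| * |x - y|) ≤ |κ| * (2 * T * δ₁) := by gcongr
        _ = _ := by ring
    have h3 := le_abs_self (κ * (x ^ 2 - y ^ 2))
    have h4 := mul_le_mul_of_nonneg_left (hmle y hy) η0.le
    linarith
  have hev : ∀ᶠ d in 𝓝[>] (0 : ℝ), cosh (d / 2) < 1 + η ∧ sinh (d / 2) * M < δ₁ := by
    have c1 : Tendsto (fun d : ℝ => cosh (d / 2)) (𝓝 0) (𝓝 (cosh (0 / 2))) :=
      Continuous.tendsto (by fun_prop) 0
    have c2 : Tendsto (fun d : ℝ => sinh (d / 2) * M) (𝓝 0) (𝓝 (sinh (0 / 2) * M)) :=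
      Continuous.tendsto (by fun_prop) 0
    exact ((c1.mono_left nhdsWithin_le_nhds).eventually_lt_const (by simpa)).and
      ((c2.mono_left nhdsWithin_le_nhds).eventually_lt_const (by simpa))
  obtain ⟨δ₂, ⟨hδ₂c, hδ₂s⟩, δ₂0⟩ := (hev.and self_mem_nhdsWithin).exists
  have δ₂0 : 0 < δ₂ := δ₂0
  refine ⟨min δ₁ δ₂, lt_min δ₁0 δ₂0, fun x hx y hy d hd hsd => ?_⟩
  have px := m0.trans_le (hmle x hx)
  have py := m0.trans_le (hmle y hy)
  -- Chord and arc differ only in the denominator: `s`, the geometric mean of the values at the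
  -- endpoints, against the value at an intermediate `ξ`. By `hcmp` these are close for close
  -- endpoints.
  set s := √((1 + κ * x ^ 2) * (1 + κ * y ^ 2)) with hs
  have s0 : 0 < s := sqrt_pos.2 (mul_pos px py)
  have s2 : s ^ 2 = (1 + κ * x ^ 2) * (1 + κ * y ^ 2) := sq_sqrt (mul_pos px py).le
  have hsinh : sinh (d / 2) = |x - y| / s := by
    have h0 : 0 ≤ sinh (d / 2) := sinh_nonneg_iff.2 (by linarith)
    rw [← abs_of_nonneg h0, ← sqrt_sq_eq_abs, hsd, ← s2, sqrt_div (sq_nonneg _), sqrt_sq_eq_abs,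
      sqrt_sq s0.le]
  obtain ⟨ξ, hξ, hxξ, hyξ, e⟩ := exists_abs_arcIntegral_sub_eq hT hx hy
  have pξ := m0.trans_le (hmle ξ hξ)
  have hG : |2 * arcIntegral k x - 2 * arcIntegral k y| = 2 * (|x - y| / (1 + κ * ξ ^ 2)) := by
    rw [← mul_sub, abs_mul, e, abs_two]
  have hself : d / 2 ≤ sinh (d / 2) := self_le_sinh_iff.2 (by linarith)
  rw [hG]
  constructor
  · intro hxy
    have hxy := hxy.trans_le (min_le_left _ _)
    have h1 : 1 + κ * ξ ^ 2 ≤ (1 + η) * s := by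
      refine le_of_sq_le_sq ?_ (by positivity)
      have := hcmp ξ hξ x hx (by rw [abs_sub_comm]; linarith)
      have := hcmp ξ hξ y hy (by rw [abs_sub_comm]; linarith)
      rw [mul_pow, s2]
      calc (1 + κ * ξ ^ 2) ^ 2 = (1 + κ * ξ ^ 2) * (1 + κ * ξ ^ 2) := sq _
        _ ≤ ((1 + η) * (1 + κ * x ^ 2)) * ((1 + η) * (1 + κ * y ^ 2)) := by gcongr
        _ = _ := by ring
    have h2 : |x - y| / s ≤ (1 + η) * (|x - y| / (1 + κ * ξ ^ 2)) := by
      rw [← mul_div_assoc, div_le_div_iff₀ s0 pξ]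
      exact (mul_le_mul_of_nonneg_left h1 (abs_nonneg (x - y))).trans_eq (by ring)
    have h3 : (0 : ℝ) ≤ |x - y| / (1 + κ * ξ ^ 2) := by positivity
    have h4 : (1 + η) * (|x - y| / (1 + κ * ξ ^ 2)) ≤ (1 + ε) * (|x - y| / (1 + κ * ξ ^ 2)) :=
      mul_le_mul_of_nonneg_right (by linarith) h3
    linarith
  · intro hdδ
    have hdδ := hdδ.trans_le (min_le_right _ _)
    have hxy : |x - y| < δ₁ := by
      have h1 : s ≤ M := by
        refine sqrt_le_iff.2 ⟨M0.le, ?_⟩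
        rw [sq M]
        exact mul_le_mul (hMle x hx) (hMle y hy) py.le M0.le
      have h2 : sinh (d / 2) ≤ sinh (δ₂ / 2) := sinh_le_sinh.2 (by linarith)
      have h3 : |x - y| = sinh (d / 2) * s := by rw [hsinh]; field_simp
      have h4 : 0 ≤ sinh (d / 2) := sinh_nonneg_iff.2 (by linarith)
      rw [h3]
      exact (mul_le_mul h2 h1 s0.le (h4.trans h2)).trans_lt hδ₂s
    have h1 : s ≤ (1 + η) * (1 + κ * ξ ^ 2) := by
      refine sqrt_le_iff.2 ⟨by positivity, ?_⟩
      have := hcmp x hx ξ hξ (by linarith)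
      have := hcmp y hy ξ hξ (by linarith)
      rw [sq ((1 + η) * (1 + κ * ξ ^ 2))]
      gcongr
    have h2 : |x - y| / (1 + κ * ξ ^ 2) ≤ (1 + η) * sinh (d / 2) := by
      rw [hsinh, ← mul_div_assoc, div_le_div_iff₀ pξ s0]
      exact (mul_le_mul_of_nonneg_left h1 (abs_nonneg (x - y))).trans_eq (by ring)
    have h5 : sinh (d / 2) ≤ cosh (d / 2) * (d / 2) := sinh_le_cosh_mul_self (by linarith)
    have h6 : cosh (d / 2) ≤ 1 + η := by
      refine le_trans (cosh_le_cosh.2 ?_) hδ₂c.le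
      rw [abs_of_nonneg (by linarith), abs_of_nonneg (by linarith)]; linarith
    have h7 : sinh (d / 2) ≤ (1 + η) * (d / 2) :=
      h5.trans (mul_le_mul_of_nonneg_right h6 (by linarith))
    have h8 : |x - y| / (1 + κ * ξ ^ 2) ≤ (1 + η) * ((1 + η) * (d / 2)) :=
      h2.trans (mul_le_mul_of_nonneg_left h7 (by positivity))
    have h9 : (1 + η) * (1 + η) ≤ 1 + ε := by
      have := mul_le_of_le_one_left η0.le η1
      linarith
    calc 2 * (|x - y| / (1 + κ * ξ ^ 2)) ≤ 2 * ((1 + η) * ((1 + η) * (d / 2))) :=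
          mul_le_mul_of_nonneg_left h8 two_pos.le
      _ = (1 + η) * (1 + η) * d := by ring
      _ ≤ (1 + ε) * d := mul_le_mul_of_nonneg_right h9 hd

end ArcIntegral

/-! ### Parametrization of cycles -/

section ArcPoint

variable {k : ℝ} (N : Cycle k) (p : ℍ)

/-- The denominator of the Möbius transformation with parameter `x` that preserves a cycle. -/
noncomputable def Cycle.arcDenom (x : ℝ) : ℂ := 1 - N.b * x - 2 * N.a * x * p

/-- The numerator of the Möbius transformation with parameter `x` that preserves a cycle. -/
noncomputable def Cycle.arcNum (x : ℝ) : ℂ := (1 + N.b * x) * p + 2 * N.c * x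

/-- The image of `p` under the Möbius transformation with parameter `x` that preserves a cycle. -/
noncomputable def Cycle.arcPoint (x : ℝ) : ℍ :=
  UpperHalfPlane.ofComplex (N.arcNum p x / N.arcDenom p x)

variable {N p}

lemma Cycle.normSq_arcDenom_pos {x : ℝ} (hx : 0 < 1 + (k ^ 2 - 1) * x ^ 2) :
    0 < Complex.normSq (N.arcDenom p x) := by
  refine Complex.normSq_pos.2 fun h => ?_
  have hre := congrArg Complex.re h
  have him := congrArg Complex.im h
  simp [Cycle.arcDenom] at hre him
  have hd := N.discrim_eq
  have hax : N.a * x = 0 := by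
    rcases him with h | h
    · rcases h with h | h <;> simp [h]
    · exact absurd h p.im_pos.ne'
  have hbx : N.b * x = 1 := by
    have : 2 * N.a * x * p.re = 2 * (N.a * x) * p.re := by ring
    rw [this, hax] at hre; linarith
  have : 1 + (k ^ 2 - 1) * x ^ 2 = 0 := by
    linear_combination x ^ 2 * hd - (N.b * x + 1) * hbx + 4 * N.c * x * hax
  linarith

/-- The matrix with rows `(1 + bx, 2cx)` and `(-2ax, 1 - bx)` has determinant `1 - (b² - 4ac) x² = 1
+ (k² - 1) x²`. It is `1 + xM` for a trace-free `M`, and the Möbius transformations commuting with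
`M` preserve `(a|z|² + b Re z + c) / Im z`, hence the cycle. -/
lemma Cycle.im_arcNum_div (x : ℝ) :
    (N.arcNum p x / N.arcDenom p x).im =
      p.im * (1 + (k ^ 2 - 1) * x ^ 2) / Complex.normSq (N.arcDenom p x) := by
  rw [Complex.div_im, ← sub_div]
  congr 1
  simp [Cycle.arcNum, Cycle.arcDenom]
  linear_combination -p.im * x ^ 2 * N.discrim_eq

variable {x y : ℝ}

lemma Cycle.coe_arcPoint (hx : 0 < 1 + (k ^ 2 - 1) * x ^ 2) :
    (N.arcPoint p x : ℂ) = N.arcNum p x / N.arcDenom p x := by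
  have h : 0 < (N.arcNum p x / N.arcDenom p x).im := by
    rw [Cycle.im_arcNum_div]
    exact div_pos (mul_pos p.im_pos hx) (Cycle.normSq_arcDenom_pos hx)
  rw [Cycle.arcPoint, UpperHalfPlane.ofComplex_apply_of_im_pos h]

lemma Cycle.arcPoint_im (hx : 0 < 1 + (k ^ 2 - 1) * x ^ 2) :
    (N.arcPoint p x).im =
      p.im * (1 + (k ^ 2 - 1) * x ^ 2) / Complex.normSq (N.arcDenom p x) := by
  rw [← Cycle.im_arcNum_div, ← Cycle.coe_arcPoint hx]; rfl

lemma Cycle.arcPoint_zero : N.arcPoint p 0 = p := by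
  rw [Cycle.arcPoint]
  simp [Cycle.arcNum, Cycle.arcDenom, UpperHalfPlane.ofComplex_apply]

lemma Cycle.form_eq_zero_iff {z : ℍ} :
    N.form z = 0 ↔ N.a * Complex.normSq z + N.b * z.re + N.c = k * z.im := by
  rw [Cycle.form, sub_eq_zero, Complex.normSq_apply]
  simp [sq]

lemma Cycle.form_arcPoint (hp : N.form p = 0) (hx : 0 < 1 + (k ^ 2 - 1) * x ^ 2) :
    N.form (N.arcPoint p x) = 0 := by
  have hn := Cycle.normSq_arcDenom_pos (N := N) (p := p) hx
  rw [Cycle.form_eq_zero_iff, Cycle.arcPoint_im hx]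
  have hre : (N.arcPoint p x).re = ((N.arcNum p x).re * (N.arcDenom p x).re +
      (N.arcNum p x).im * (N.arcDenom p x).im) / Complex.normSq (N.arcDenom p x) := by
    have : (N.arcPoint p x).re = (N.arcPoint p x : ℂ).re := rfl
    rw [this, Cycle.coe_arcPoint hx, Complex.div_re, add_div]
  rw [hre, Cycle.coe_arcPoint hx, Complex.normSq_div]
  field_simp
  have h1 : (N.arcNum p x).re = (1 + N.b * x) * p.re + 2 * N.c * x := by simp [Cycle.arcNum]
  have h2 : (N.arcNum p x).im = (1 + N.b * x) * p.im := by simp [Cycle.arcNum]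
  have h3 : (N.arcDenom p x).re = 1 - N.b * x - 2 * N.a * x * p.re := by simp [Cycle.arcDenom]
  have h4 : (N.arcDenom p x).im = -(2 * N.a * x * p.im) := by simp [Cycle.arcDenom]
  rw [Complex.normSq_apply, Complex.normSq_apply, h1, h2, h3, h4]
  have hd := N.discrim_eq
  simp only [Cycle.form] at hp
  linear_combination (1 + (k ^ 2 - 1) * x ^ 2) * hp -
    x ^ 2 * (N.a * (p.re ^ 2 + p.im ^ 2) + N.b * p.re + N.c) * hd

lemma Cycle.normSq_quadratic (hp : N.form p = 0) :
    Complex.normSq (N.a * (p : ℂ) ^ 2 + N.b * p + N.c) = p.im ^ 2 := by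
  have hd := N.discrim_eq
  rw [Complex.normSq_apply]
  simp only [Cycle.form] at hp
  simp [sq]
  linear_combination
    (N.a * (p.re ^ 2 + p.im ^ 2) + N.b * p.re + N.c + k * p.im) * hp + p.im ^ 2 * hd

/-- The difference of the two points is `2 (x - y)` times `a p² + b p + c` over the product of the
denominators, and on the cycle this quadratic has modulus `Im p`. All dependence on `p` cancels. -/
lemma Cycle.sinh_half_dist_arcPoint (hp : N.form p = 0) (hx : 0 < 1 + (k ^ 2 - 1) * x ^ 2)
    (hy : 0 < 1 + (k ^ 2 - 1) * y ^ 2) :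
    sinh (dist (N.arcPoint p x) (N.arcPoint p y) / 2) ^ 2 =
      (x - y) ^ 2 / ((1 + (k ^ 2 - 1) * x ^ 2) * (1 + (k ^ 2 - 1) * y ^ 2)) := by
  have nx := Cycle.normSq_arcDenom_pos (N := N) (p := p) hx
  have ny := Cycle.normSq_arcDenom_pos (N := N) (p := p) hy
  have hq := Cycle.normSq_quadratic hp
  have h0 := p.im_pos
  have e : ((N.arcPoint p x).re - (N.arcPoint p y).re) ^ 2 +
      ((N.arcPoint p x).im - (N.arcPoint p y).im) ^ 2 =
      Complex.normSq ((N.arcPoint p x : ℂ) - N.arcPoint p y) := by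
    rw [Complex.normSq_apply]; simp [sq]
  have e2 : (N.arcPoint p x : ℂ) - N.arcPoint p y =
      ((2 * (x - y) : ℝ) : ℂ) * (N.a * (p : ℂ) ^ 2 + N.b * p + N.c) /
        (N.arcDenom p x * N.arcDenom p y) := by
    have dx : N.arcDenom p x ≠ 0 := Complex.normSq_pos.1 nx
    have dy : N.arcDenom p y ≠ 0 := Complex.normSq_pos.1 ny
    rw [Cycle.coe_arcPoint hx, Cycle.coe_arcPoint hy, div_sub_div _ _ dx dy]
    congr 1
    simp only [Cycle.arcNum, Cycle.arcDenom]
    push_cast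
    ring
  rw [sinh_half_dist_sq, e, e2, Complex.normSq_div, Complex.normSq_mul, Complex.normSq_mul,
    Complex.normSq_ofReal, hq, Cycle.arcPoint_im hx, Cycle.arcPoint_im hy]
  field_simp
  ring

/-- Every point of the cycle that is not too far from `p` is of the form `N.arcPoint p x`. -/
lemma Cycle.exists_arcPoint_eq (hp : N.form p = 0) {z : ℍ} (hz : N.form z = 0)
    (h : 0 < 1 - (k ^ 2 - 1) * sinh (dist z p / 2) ^ 2) :
    ∃ x : ℝ, N.arcPoint p x = z ∧ 0 < 1 + (k ^ 2 - 1) * x ^ 2 ∧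
      x ^ 2 = sinh (dist z p / 2) ^ 2 / (1 - (k ^ 2 - 1) * sinh (dist z p / 2) ^ 2) := by
  have hd := N.discrim_eq
  have yz := z.im_pos
  have yp := p.im_pos
  -- Clearing denominators, `N.arcPoint p x = z` reads `z - p = x Q`. The quotient is real because
  -- both points lie on the cycle (`him`), and `h` gives `Q ≠ 0`; for a circle it excludes just the
  -- antipode of `p`.
  set Q : ℂ := 2 * N.a * z * p + N.b * (z + p) + 2 * N.c with hQ
  set S := sinh (dist z p / 2) ^ 2 with hS
  have hS2 : Complex.normSq ((z : ℂ) - p) = 4 * z.im * p.im * S := by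
    rw [hS, sinh_half_dist_sq, Complex.normSq_apply]; simp; field_simp
  have hp' : N.a * (p.re ^ 2 + p.im ^ 2) + N.b * p.re + N.c - k * p.im = 0 := hp
  have hz' : N.a * (z.re ^ 2 + z.im ^ 2) + N.b * z.re + N.c - k * z.im = 0 := hz
  have hQn : Complex.normSq Q = 4 * z.im * p.im * (1 - (k ^ 2 - 1) * S) := by
    have h1 : Complex.normSq Q + (k ^ 2 - 1) * Complex.normSq ((z : ℂ) - p) =
        4 * z.im * p.im := by
      rw [Complex.normSq_apply, Complex.normSq_apply]
      simp [hQ]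
      linear_combination 4 * (N.a * (p.re ^ 2 + p.im ^ 2) + N.b * p.re + N.c) * hz' +
        4 * k * z.im * hp' +
        ((z.re - p.re) ^ 2 + (z.im - p.im) ^ 2 + 4 * z.im * p.im) * hd
    rw [hS2] at h1
    linarith
  have hQ0 : 0 < Complex.normSq Q := by rw [hQn]; positivity
  have him : (((z : ℂ) - p) * (starRingEnd ℂ) Q).im = 0 := by
    simp [hQ]
    linear_combination 2 * z.im * hp' - 2 * p.im * hz'
  set x : ℝ := (((z : ℂ) - p) * (starRingEnd ℂ) Q).re / Complex.normSq Q with hx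
  have hxQ : (z : ℂ) - p = x * Q := by
    have h1 : ((z : ℂ) - p) * (starRingEnd ℂ) Q = (x * Complex.normSq Q : ℝ) := by
      apply Complex.ext
      · rw [Complex.ofReal_re, hx]; field_simp
      · rw [Complex.ofReal_im, him]
    have hQc : (starRingEnd ℂ) Q ≠ 0 := by
      rw [Ne, map_eq_zero]; exact Complex.normSq_pos.1 hQ0
    refine mul_right_cancel₀ hQc ?_
    rw [h1, mul_assoc, Complex.mul_conj]; push_cast; ring
  have hx2 : x ^ 2 = S / (1 - (k ^ 2 - 1) * S) := by
    have h1 := congrArg Complex.normSq hxQ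
    rw [hS2, Complex.normSq_mul, Complex.normSq_ofReal, hQn] at h1
    rw [eq_div_iff h.ne']
    have : 0 < 4 * z.im * p.im := by positivity
    refine mul_left_cancel₀ this.ne' ?_
    linarith
  have hΔ : 0 < 1 + (k ^ 2 - 1) * x ^ 2 := by
    have : 1 + (k ^ 2 - 1) * x ^ 2 = 1 / (1 - (k ^ 2 - 1) * S) := by
      rw [hx2]; field_simp; ring
    rw [this]; positivity
  refine ⟨x, UpperHalfPlane.ext ?_, hΔ, hx2⟩
  have dx : N.arcDenom p x ≠ 0 := Complex.normSq_pos.1 (Cycle.normSq_arcDenom_pos hΔ)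
  rw [Cycle.coe_arcPoint hΔ, div_eq_iff dx, Cycle.arcNum, Cycle.arcDenom]
  linear_combination hxQ * (-1)

end ArcPoint

/-! ### Lengths of arcs of cycles -/

section ArcLength

variable {k : ℝ} {N : Cycle k} {p q : ℍ} {T : ℝ}

lemma eVariationOn_le_of_edist_le {E E' : Type*} [PseudoEMetricSpace E] [PseudoEMetricSpace E']
    {f : ℝ → E} {g : ℝ → E'} {s : Set ℝ}
    (h : ∀ x ∈ s, ∀ y ∈ s, edist (f x) (f y) ≤ edist (g x) (g y)) :
    eVariationOn f s ≤ eVariationOn g s :=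
  iSup_le fun u => (Finset.sum_le_sum fun i _ => h _ (u.2.2.2 (i + 1)) _ (u.2.2.2 i)).trans
    (eVariationOn.sum_le u.2.2.1 u.2.2.2)

/-- Short chords are at most `1 + ε` times the corresponding increments of `2 * arcIntegral`; these
increments add up exactly, by monotonicity. -/
lemma edist_arcPoint_le (hp : N.form p = 0) (hT : 0 < 1 + (k ^ 2 - 1) * T ^ 2) {x y : ℝ}
    (hx : x ∈ Icc (-T) T) (hy : y ∈ Icc (-T) T) :
    edist (N.arcPoint p x) (N.arcPoint p y) ≤ edist (2 * arcIntegral k x) (2 * arcIntegral k y) := by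
  have hT0 : 0 ≤ T := by linarith [hx.1, hx.2]
  wlog hxy : x ≤ y generalizing x y
  · rw [edist_comm, edist_comm (2 * arcIntegral k x)]
    exact this hy hx (le_of_not_ge hxy)
  have hsub : Icc x y ⊆ Icc (-T) T := Icc_subset_Icc hx.1 hy.2
  have hmono : MonotoneOn (fun x => 2 * arcIntegral k x) (Icc x y) :=
    fun s hs t ht hst => mul_le_mul_of_nonneg_left
      (monotoneOn_arcIntegral hT (hsub hs) (hsub ht) hst) two_pos.le
  have h1 : edist (N.arcPoint p x) (N.arcPoint p y) ≤
      eVariationOn (fun x => 2 * arcIntegral k x) (Icc x y) := by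
    refine edist_le_eVariationOn_of_forall hxy fun ε hε => ?_
    obtain ⟨δ, hδ, H⟩ := exists_chord_arc_comparison (k := k) hT0 hT hε
    refine ⟨δ, hδ, fun s hs t ht hst => ?_⟩
    have h2 := (H s (hsub hs) t (hsub ht) (dist (N.arcPoint p s) (N.arcPoint p t)) dist_nonneg
      (Cycle.sinh_half_dist_arcPoint hp (one_add_mul_sq_pos_of_abs_le hT (hsub hs))
        (one_add_mul_sq_pos_of_abs_le hT (hsub ht)))).1 hst
    rw [edist_dist, edist_dist, ← ENNReal.ofReal_mul (by positivity), Real.dist_eq]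
    exact ENNReal.ofReal_le_ofReal h2
  have h2 := hmono.eVariationOn_eq ⟨le_rfl, hxy⟩ ⟨hxy, le_rfl⟩
  rw [inter_self] at h2
  refine (h1.trans_eq h2).trans ?_
  rw [edist_dist, dist_comm, Real.dist_eq]
  exact ENNReal.ofReal_le_ofReal (le_abs_self _)

lemma exists_path_eVariationOn_le (hp : N.form p = 0) {x : ℝ}
    (hx : 0 < 1 + (k ^ 2 - 1) * x ^ 2) :
    ∃ γ : ℝ → ℍ, ContinuousOn γ (Icc 0 1) ∧ (∀ t ∈ Icc (0 : ℝ) 1, N.form (γ t) = 0) ∧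
      γ 0 = p ∧ γ 1 = N.arcPoint p x ∧
      eVariationOn γ (Icc 0 1) ≤ ENNReal.ofReal (2 * arcIntegral k |x|) := by
  have hT : 0 < 1 + (k ^ 2 - 1) * |x| ^ 2 := by rwa [sq_abs]
  have hmem : ∀ t ∈ Icc (0 : ℝ) 1, t * x ∈ Icc (-|x|) |x| := fun t ht => by
    rw [mem_Icc, ← abs_le, abs_mul, abs_of_nonneg ht.1]
    exact mul_le_of_le_one_left (abs_nonneg x) ht.2
  have hmem' : ∀ t ∈ Icc (0 : ℝ) 1, t * |x| ∈ Icc (-|x|) |x| := fun t ht => by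
    rw [mem_Icc, ← abs_le, abs_mul, abs_of_nonneg ht.1, abs_abs]
    exact mul_le_of_le_one_left (abs_nonneg x) ht.2
  have hle : ∀ s ∈ Icc (0 : ℝ) 1, ∀ t ∈ Icc (0 : ℝ) 1,
      edist (N.arcPoint p (s * x)) (N.arcPoint p (t * x)) ≤
        edist (2 * arcIntegral k (s * |x|)) (2 * arcIntegral k (t * |x|)) := fun s hs t ht => by
    refine (edist_arcPoint_le hp hT (hmem s hs) (hmem t ht)).trans_eq ?_
    rcases le_total 0 x with h | h
    · rw [abs_of_nonneg h]
    · rw [abs_of_nonpos h, mul_neg, mul_neg, arcIntegral_neg, arcIntegral_neg, mul_neg, mul_neg,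
        edist_neg_neg]
  have hc : ContinuousOn (fun t => 2 * arcIntegral k (t * |x|)) (Icc 0 1) :=
    continuousOn_const.mul ((continuousOn_arcIntegral hT).comp (by fun_prop) hmem')
  have hm : MonotoneOn (fun t => 2 * arcIntegral k (t * |x|)) (Icc 0 1) := fun s hs t ht hst =>
    mul_le_mul_of_nonneg_left (monotoneOn_arcIntegral hT (hmem' s hs) (hmem' t ht)
      (mul_le_mul_of_nonneg_right hst (abs_nonneg x))) two_pos.le
  refine ⟨fun t => N.arcPoint p (t * x), ?_, fun t ht => ?_, ?_, ?_, ?_⟩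
  · intro t ht
    have := hc t ht
    rw [ContinuousWithinAt, tendsto_iff_edist_tendsto_0] at this ⊢
    refine tendsto_of_tendsto_of_tendsto_of_le_of_le' tendsto_const_nhds this
      (Eventually.of_forall fun _ => zero_le) ?_
    exact eventually_mem_nhdsWithin.mono fun s hs => hle s hs t ht
  · exact Cycle.form_arcPoint hp (one_add_mul_sq_pos_of_abs_le hT (hmem t ht))
  · simp only [zero_mul]; exact Cycle.arcPoint_zero
  · simp only [one_mul]
  · refine (eVariationOn_le_of_edist_le hle).trans ?_
    have h1 := hm.eVariationOn_eq (a := 0) (b := 1) (by simp) (by simp)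
    rw [inter_self] at h1
    simpa [arcIntegral_zero] using h1.le

lemma le_eVariationOn_of_path (hp : N.form p = 0)
    (hpq : 0 < 1 - (k ^ 2 - 1) * sinh (dist q p / 2) ^ 2) (hT0 : 0 ≤ T)
    (hT : T ^ 2 = sinh (dist q p / 2) ^ 2 / (1 - (k ^ 2 - 1) * sinh (dist q p / 2) ^ 2))
    {γ : ℝ → ℍ} (hγ : ContinuousOn γ (Icc 0 1)) (hN : ∀ t ∈ Icc (0 : ℝ) 1, N.form (γ t) = 0)
    (h0 : γ 0 = p) (h1 : γ 1 = q) :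
    ENNReal.ofReal (2 * arcIntegral k T) ≤ eVariationOn γ (Icc 0 1) := by
  have hTpos : 0 < 1 + (k ^ 2 - 1) * T ^ 2 := by
    have : 1 + (k ^ 2 - 1) * T ^ 2 = 1 / (1 - (k ^ 2 - 1) * sinh (dist q p / 2) ^ 2) := by
      rw [hT]; field_simp; ring
    rw [this]; positivity
  set d : ℝ → ℝ := fun t => dist (γ t) p with hd
  have hdc : ContinuousOn d (Icc 0 1) := continuous_dist.comp_continuousOn (hγ.prodMk continuousOn_const)
  -- The path may go beyond `q` or around the circle. Cut at the first time its distance from `p` is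
  -- that of `q`, it stays in the range of parameters `[-T, T]`.
  obtain ⟨t₁, ⟨ht₁, hdt₁⟩, hleast⟩ : ∃ t, IsLeast (Icc 0 1 ∩ d ⁻¹' {dist q p}) t := by
    refine IsCompact.exists_isLeast ?_ ⟨1, by simp, by simp [hd, h1]⟩
    exact isCompact_Icc.of_isClosed_subset
      (hdc.preimage_isClosed_of_isClosed isClosed_Icc isClosed_singleton) inter_subset_left
  have hdt₁ : d t₁ = dist q p := hdt₁
  have hsub : Icc 0 t₁ ⊆ Icc (0 : ℝ) 1 := Icc_subset_Icc le_rfl ht₁.2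
  have hdle : ∀ t ∈ Icc 0 t₁, d t ≤ dist q p := by
    intro t ht
    by_contra! hlt
    have hd0 : d 0 ≤ dist q p := by simp [hd, h0]
    obtain ⟨s, hs, hsd⟩ := intermediate_value_Icc ht.1
      (hdc.mono (Icc_subset_Icc le_rfl (ht.2.trans ht₁.2))) ⟨hd0, hlt.le⟩
    have h2 : t₁ ≤ s := hleast ⟨⟨hs.1, hs.2.trans (ht.2.trans ht₁.2)⟩, hsd⟩
    have h3 : t = t₁ := le_antisymm ht.2 (h2.trans hs.2)
    rw [h3, hdt₁] at hlt
    exact lt_irrefl _ hlt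
  have hS : ∀ t ∈ Icc 0 t₁, sinh (d t / 2) ^ 2 ≤ sinh (dist q p / 2) ^ 2 := fun t ht => by
    refine pow_le_pow_left₀ (sinh_nonneg_iff.2 (by positivity)) (sinh_le_sinh.2 ?_) 2
    linarith [hdle t ht]
  have hpos : ∀ t ∈ Icc 0 t₁, 0 < 1 - (k ^ 2 - 1) * sinh (d t / 2) ^ 2 := fun t ht => by
    have := hS t ht
    rcases le_total 0 (k ^ 2 - 1) with h | h
    · nlinarith
    · nlinarith [sq_nonneg (sinh (d t / 2))]
  have hex : ∀ t ∈ Icc 0 t₁, ∃ x : ℝ, N.arcPoint p x = γ t ∧ 0 < 1 + (k ^ 2 - 1) * x ^ 2 ∧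
      x ^ 2 = sinh (d t / 2) ^ 2 / (1 - (k ^ 2 - 1) * sinh (d t / 2) ^ 2) := fun t ht =>
    Cycle.exists_arcPoint_eq hp (hN t (hsub ht)) (hpos t ht)
  -- The parameters are merely chosen, without continuity: the comparison below bounds increments of
  -- `arcIntegral` by the distances of the points themselves.
  choose! x hxγ hxpos hxsq using hex
  have hxT : ∀ t ∈ Icc 0 t₁, x t ∈ Icc (-T) T := fun t ht => by
    rw [mem_Icc, ← abs_le, ← abs_of_nonneg hT0]
    refine sq_le_sq.1 ?_
    rw [hxsq t ht, hT, div_le_div_iff₀ (hpos t ht) hpq]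
    linarith [hS t ht]
  have hm0 : (0 : ℝ) ∈ Icc 0 t₁ := ⟨le_rfl, ht₁.1⟩
  have hm1 : t₁ ∈ Icc 0 t₁ := ⟨ht₁.1, le_rfl⟩
  have hx0 : x 0 = 0 := by
    have := hxsq 0 hm0
    simpa [hd, h0] using this
  have hx1 : |x t₁| = T := by
    rw [← abs_of_nonneg hT0]
    refine (sq_eq_sq_iff_abs_eq_abs _ _).1 ?_
    rw [hxsq t₁ hm1, hT, hdt₁]
  have key : edist (2 * arcIntegral k (x 0)) (2 * arcIntegral k (x t₁)) ≤
      eVariationOn γ (Icc 0 t₁) := by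
    refine edist_le_eVariationOn_of_forall (f := fun t => 2 * arcIntegral k (x t)) ht₁.1
      fun ε hε => ?_
    obtain ⟨δ, hδ, H⟩ := exists_chord_arc_comparison (k := k) hT0 hTpos hε
    obtain ⟨δ', hδ', H'⟩ := Metric.uniformContinuousOn_iff.1
      (isCompact_Icc.uniformContinuousOn_of_continuous (hγ.mono hsub)) δ hδ
    refine ⟨δ', hδ', fun s hs t ht hst => ?_⟩
    have h2 := (H (x s) (hxT s hs) (x t) (hxT t ht) (dist (γ s) (γ t)) dist_nonneg (by
      rw [← hxγ s hs, ← hxγ t ht]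
      exact Cycle.sinh_half_dist_arcPoint hp (hxpos s hs) (hxpos t ht))).2
      (H' s hs t ht hst)
    rw [edist_dist, edist_dist, ← ENNReal.ofReal_mul (by positivity), Real.dist_eq]
    exact ENNReal.ofReal_le_ofReal h2
  refine le_trans ?_ (key.trans (eVariationOn.mono γ hsub))
  rw [hx0, arcIntegral_zero, mul_zero, edist_dist, Real.dist_eq, zero_sub, abs_neg]
  refine ENNReal.ofReal_le_ofReal ?_
  -- At time `t₁` the path may be at parameter `T` or `-T`; the arcs from `p` are equally long.
  rcases abs_choice (x t₁) with h | h
  · rw [← hx1, h]; exact le_abs_self _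
  · rw [← hx1, h, arcIntegral_neg, mul_neg]; exact neg_le_abs _

/-- The length of the shorter arc of a cycle between two points. -/
theorem arcLengthBetween_eq (hp : N.form p = 0) (hq : N.form q = 0)
    (hpq : 0 < 1 - (k ^ 2 - 1) * sinh (dist q p / 2) ^ 2) (hT0 : 0 ≤ T)
    (hT : T ^ 2 = sinh (dist q p / 2) ^ 2 / (1 - (k ^ 2 - 1) * sinh (dist q p / 2) ^ 2))
    {P Q : Set ℍ} (hP : ∀ z, N.form z = 0 → (z ∈ P ↔ z = p))
    (hQ : ∀ z, N.form z = 0 → (z ∈ Q ↔ z = q)) :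
    arcLengthBetween (frontier N.disc) P Q = ENNReal.ofReal (2 * arcIntegral k T) := by
  rw [Cycle.frontier_disc]
  refine le_antisymm ?_ ?_
  · obtain ⟨x, hx, hxpos, hxsq⟩ := Cycle.exists_arcPoint_eq hp hq hpq
    obtain ⟨γ, h1, h2, h3, h4, h5⟩ := exists_path_eVariationOn_le hp hxpos
    have hxT : |x| = T := by
      rw [← abs_of_nonneg hT0]
      exact (sq_eq_sq_iff_abs_eq_abs _ _).1 (by rw [hxsq, hT])
    rw [hxT] at h5
    refine (iInf₂_le γ ⟨h1, h2, ?_, ?_⟩).trans h5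
    · rw [hP _ (h2 0 (by simp)), h3]
    · rw [hQ _ (h2 1 (by simp)), h4, hx]
  · refine le_iInf₂ fun γ ⟨h1, h2, h3, h4⟩ => ?_
    refine le_eVariationOn_of_path hp hpq hT0 hT h1 h2 ?_ ?_
    · exact (hP _ (h2 0 (by simp))).1 h3
    · exact (hQ _ (h2 1 (by simp))).1 h4

end ArcLength

/-! ### Circle packings -/

section Packing

variable {V : Type*} {k : V → ℝ} {f : Finset V} {D : V → Set ℍ}

lemma arcLengthBetween_face [DecidableEq V] {v u w : V} (huv : u ≠ v) (hwv : w ≠ v) (huw : u ≠ w)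
    (hf : f = {v, u, w}) (hk : ∀ x ∈ f, 0 < k x)
    (hD : ∀ x ∈ f, IsGeneralizedDisc (k x) (D x))
    (ht : ∀ x ∈ f, ∀ y ∈ f, x ≠ y → ExternallyTangent (D x) (D y)) :
    arcLengthBetween (frontier (D v)) (frontier (D u)) (frontier (D w)) =
      ENNReal.ofReal (2 * arcIntegral (k v) (inTanh k f)) := by
  have mv : v ∈ f := by simp [hf]
  have mu : u ∈ f := by simp [hf]
  have mw : w ∈ f := by simp [hf]
  have hcard : f.card = 3 := by
    rw [hf, Finset.card_eq_three]; exact ⟨v, u, w, huv.symm, hwv.symm, huw, rfl⟩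
  obtain ⟨N, hN⟩ := exists_cycle_disc_eq (hD v mv)
  obtain ⟨N₁, hN₁⟩ := exists_cycle_disc_eq (hD u mu)
  obtain ⟨N₂, hN₂⟩ := exists_cycle_disc_eq (hD w mw)
  have t₁ := ht v mv u mu huv.symm
  have t₂ := ht v mv w mw hwv.symm
  have t₃ := ht u mu w mw huw
  rw [hN, hN₁] at t₁
  rw [hN, hN₂] at t₂
  rw [hN₁, hN₂] at t₃
  obtain ⟨p, hp, hpN, hpN₁⟩ := exists_touchAt_of_externallyTangent t₁
  obtain ⟨q, hq, hqN, hqN₂⟩ := exists_touchAt_of_externallyTangent t₂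
  obtain ⟨r, hr, -, -⟩ := exists_touchAt_of_externallyTangent t₃
  have kv := hk v mv
  have ku := hk u mu
  have kw := hk w mw
  have hS := sinh_half_dist_touchAt kv ku kw hp hq hr
  rw [dist_comm] at hS
  have hσ : pairSum k f = k v * k u + k v * k w + k u * k w := by
    rw [hf, pairSum_triple k huv.symm hwv.symm huw]
  -- Here `(k v + k u)(k v + k w) = k v² + σ`, so the parameter of the arc has square `1 / (1 + σ)`,
  -- symmetric in the three corners.
  have hden : 1 - (k v ^ 2 - 1) * sinh (dist q p / 2) ^ 2 =
      (1 + pairSum k f) / ((k v + k u) * (k v + k w)) := by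
    rw [hS, hσ]; field_simp; ring
  have hpos : 0 < 1 + pairSum k f := by linarith [pairSum_pos hcard hk]
  rw [hN, hN₁, hN₂]
  refine arcLengthBetween_eq hpN hqN (by rw [hden]; positivity) (inTanh_pos hcard hk).le ?_ ?_ ?_
  · rw [inTanh_sq hcard hk, hden, hS]; field_simp
  · intro z hz
    rw [Cycle.frontier_disc]
    exact ⟨fun h => hp.eq_of_form_eq_zero kv ku hz h, fun h => h ▸ hpN₁⟩
  · intro z hz
    rw [Cycle.frontier_disc]
    exact ⟨fun h => hq.eq_of_form_eq_zero kv kw hz h, fun h => h ▸ hqN₂⟩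

lemma exists_discs_face (hf : f.card = 3) (hk : ∀ x ∈ f, 0 < k x) :
    ∃ D : V → Set ℍ, (∀ x ∈ f, IsGeneralizedDisc (k x) (D x)) ∧
      ∀ x ∈ f, ∀ y ∈ f, x ≠ y → ExternallyTangent (D x) (D y) := by
  classical
  obtain ⟨a, b, c, hab, hac, hbc, rfl⟩ := Finset.card_eq_three.1 hf
  obtain ⟨D₁, D₂, D₃, h₁, h₂, h₃, h₁₂, h₁₃, h₂₃⟩ := exists_three_cycles (hk a (by simp))
    (hk b (by simp)) (hk c (by simp))
  have symm : ∀ {D D' : Set ℍ}, ExternallyTangent D D' → ExternallyTangent D' D :=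
    fun h => ⟨h.1.symm, by rw [inter_comm]; exact h.2⟩
  refine ⟨fun x => if x = a then D₁ else if x = b then D₂ else D₃, ?_, ?_⟩
  · intro x hx
    simp only [Finset.mem_insert, Finset.mem_singleton] at hx
    rcases hx with rfl | rfl | rfl
    · simpa using h₁
    · simpa [hab.symm] using h₂
    · simpa [hac.symm, hbc.symm] using h₃
  · intro x hx y hy hxy
    simp only [Finset.mem_insert, Finset.mem_singleton] at hx hy
    rcases hx with rfl | rfl | rfl <;> rcases hy with rfl | rfl | rfl <;>
      first
      | exact absurd rfl hxy
      | simp only [hab.symm, hac.symm, hbc.symm, if_true, if_false]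
        first
        | assumption
        | exact symm (by assumption)

variable {S : Type*} [TopologicalSpace S] [Fintype V] {T : Triangulation S V}

lemma exists_circlePacking (T : Triangulation S V) (hk : ∀ v, 0 < k v) :
    Nonempty (T.CirclePacking k) := by
  choose! D h1 h2 using fun f (hf : f ∈ T.faces) =>
    exists_discs_face (T.card_face f hf) (k := k) fun x _ => hk x
  exact ⟨⟨D, h1, h2⟩⟩

lemma faceArcLength_eq (hk : ∀ v, 0 < k v) (P : T.CirclePacking k) (hf : f ∈ T.faces) {v : V}
    (hv : v ∈ f) :
    P.faceArcLength f v = ENNReal.ofReal (2 * arcIntegral (k v) (inTanh k f)) := by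
  classical
  have key : ∀ u ∈ f, ∀ w ∈ f, u ≠ v ∧ w ≠ v ∧ u ≠ w →
      arcLengthBetween (frontier (P.disc f v)) (frontier (P.disc f u)) (frontier (P.disc f w)) =
        ENNReal.ofReal (2 * arcIntegral (k v) (inTanh k f)) := by
    intro u hu w hw ⟨huv, hwv, huw⟩
    refine arcLengthBetween_face huv hwv huw ?_ (fun x _ => hk x) (P.isGeneralizedDisc f hf)
      (P.tangent f hf)
    refine (Finset.eq_of_subset_of_card_le ?_ ?_).symm
    · intro x hx
      simp only [Finset.mem_insert, Finset.mem_singleton] at hx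
      rcases hx with rfl | rfl | rfl <;> assumption
    · rw [T.card_face f hf, Finset.card_eq_three.2 ⟨v, u, w, huv.symm, hwv.symm, huw, rfl⟩]
  obtain ⟨u, w, huw, he⟩ : ∃ u w, u ≠ w ∧ f.erase v = {u, w} := by
    rw [← Finset.card_eq_two, Finset.card_erase_of_mem hv, T.card_face f hf]
  have mu : u ∈ f.erase v := by simp [he]
  have mw : w ∈ f.erase v := by simp [he]
  rw [Finset.mem_erase] at mu mw
  refine le_antisymm ?_ ?_
  · rw [← key u mu.2 w mw.2 ⟨mu.1, mw.1, huw⟩]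
    exact iInf₂_le_of_le u mu.2 (iInf₂_le_of_le w mw.2 (iInf_le _ ⟨mu.1, mw.1, huw⟩))
  · exact le_iInf₂ fun u hu => le_iInf₂ fun w hw => le_iInf fun h => (key u hu w hw h).ge

lemma totalGeodesicCurvature_eq [DecidableEq V] (hk : ∀ v, 0 < k v) (P : T.CirclePacking k)
    (v : V) : P.totalGeodesicCurvature v = vertexCurvature T.faces k v := by
  rw [Triangulation.CirclePacking.totalGeodesicCurvature, Triangulation.CirclePacking.circleLength,
    vertexCurvature, Finset.sum_mul]
  refine Finset.sum_congr rfl fun f hf => ?_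
  rw [Finset.mem_filter] at hf
  have hc := T.card_face f hf.1
  have h := arcIntegral_pos (k := k v) (inTanh_pos hc fun x _ => hk x)
    (inTanh_lt_one hc fun x _ => hk x)
  rw [faceArcLength_eq hk P hf.1 hf.2, ENNReal.toReal_ofReal (by positivity), faceCurvature]
  ring

lemma hasTotalGeodesicCurvature_iff [DecidableEq V] {L : V → ℝ} (hk : ∀ v, 0 < k v) :
    T.HasTotalGeodesicCurvature k L ↔ ∀ v, vertexCurvature T.faces k v = L v := by
  constructor
  · rintro ⟨P, hP⟩ v
    rw [← totalGeodesicCurvature_eq hk P, hP]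
  · intro h
    obtain ⟨P⟩ := exists_circlePacking T hk
    exact ⟨P, fun v => by rw [totalGeodesicCurvature_eq hk, h]⟩

omit [Fintype V] in
-- The two sets are read off from `k`, so uniqueness of `k` entails theirs.
lemma mem_iff_of_isGeneralizedCirclePackingMetric {I₁ I₂ : Finset V}
    (h : IsGeneralizedCirclePackingMetric I₁ I₂ k) (v : V) :
    (v ∈ I₁ ↔ k v < 1) ∧ (v ∈ I₂ ↔ k v = 1) := by
  have h1 := h.lt_one v
  have h2 := h.eq_one v
  have h3 := h.one_lt v
  by_cases m1 : v ∈ I₁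
  · have m2 : v ∉ I₂ := Finset.disjoint_left.1 h.disjoint m1
    simp [m1, m2, h1 m1, (h1 m1).ne]
  · by_cases m2 : v ∈ I₂
    · simp [m1, m2, h2 m2]
    · simp [m1, m2, (h3 m1 m2).le, (h3 m1 m2).ne']

lemma isGeneralizedCirclePackingMetric_filter (hk : ∀ v, 0 < k v) :
    IsGeneralizedCirclePackingMetric (Finset.univ.filter fun v => k v < 1)
      (Finset.univ.filter fun v => k v = 1) k := by
  refine ⟨?_, hk, by simp, by simp, fun v h1 h2 => ?_⟩
  · refine Finset.disjoint_left.2 fun v h1 h2 => ?_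
    simp only [Finset.mem_filter, Finset.mem_univ, true_and] at h1 h2
    exact h1.ne h2
  · simp only [Finset.mem_filter, Finset.mem_univ, true_and, not_lt] at h1 h2
    exact lt_of_le_of_ne h1 (Ne.symm h2)

end Packing

end GeneralizedPacking

theorem theorem1p2 {S : Type*} [TopologicalSpace S] [T2Space S] [CompactSpace S]
    [ConnectedSpace S] [ChartedSpace (EuclideanSpace ℝ (Fin 2)) S]
    {V : Type*} [Fintype V] [DecidableEq V] (T : Triangulation S V) (L : V → ℝ) :
    ((∃ (I₁ I₂ : Finset V) (k : V → ℝ),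
        IsGeneralizedCirclePackingMetric I₁ I₂ k ∧ T.HasTotalGeodesicCurvature k L) ↔
      (∀ v, 0 < L v) ∧
        ∀ I : Finset V, I.Nonempty → ∑ v ∈ I, L v < Real.pi * (T.facesMeeting I).card) ∧
    (∀ (I₁ I₂ J₁ J₂ : Finset V) (k k' : V → ℝ),
      IsGeneralizedCirclePackingMetric I₁ I₂ k → T.HasTotalGeodesicCurvature k L →
      IsGeneralizedCirclePackingMetric J₁ J₂ k' → T.HasTotalGeodesicCurvature k' L →
      I₁ = J₁ ∧ I₂ = J₂ ∧ k = k') := by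
  have hF := T.card_face
  have hV := T.exists_face
  refine ⟨⟨?_, ?_⟩, ?_⟩
  · rintro ⟨I₁, I₂, k, hk, hL⟩
    have hL := (GeneralizedPacking.hasTotalGeodesicCurvature_iff hk.pos).1 hL
    refine ⟨fun v => ?_, fun I hI => ?_⟩
    · rw [← hL v]
      exact GeneralizedPacking.vertexCurvature_pos hF hV hk.pos v
    · simp only [← hL]
      exact GeneralizedPacking.sum_vertexCurvature_lt hF hV hk.pos hI
  · rintro ⟨hpos, hL⟩
    obtain ⟨k, hk, hkL⟩ := GeneralizedPacking.exists_vertexCurvature_eq hF hpos hL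
    exact ⟨_, _, k, GeneralizedPacking.isGeneralizedCirclePackingMetric_filter hk,
      (GeneralizedPacking.hasTotalGeodesicCurvature_iff hk).2 hkL⟩
  · intro I₁ I₂ J₁ J₂ k k' hk hL hk' hL'
    have hL := (GeneralizedPacking.hasTotalGeodesicCurvature_iff hk.pos).1 hL
    have hL' := (GeneralizedPacking.hasTotalGeodesicCurvature_iff hk'.pos).1 hL'
    obtain rfl : k = k' := GeneralizedPacking.vertexCurvature_injective hF hV hk.pos hk'.pos
      fun v => (hL v).trans (hL' v).symm
    have h := GeneralizedPacking.mem_iff_of_isGeneralizedCirclePackingMetric hk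
    have h' := GeneralizedPacking.mem_iff_of_isGeneralizedCirclePackingMetric hk'
    refine ⟨Finset.ext fun v => ?_, Finset.ext fun v => ?_, rfl⟩
    · rw [(h v).1, (h' v).1]
    · rw [(h v).2, (h' v).2]
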